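/- Let $k$ be an algebraically closed field of characteristic $p\ge 5$, let $O=k[X,Y]/(X^p,Y^p)$ with $x,y$ the images of $X,Y$, and write $x^{(i)}=x^i/i!$, $y^{(j)}=y^j/j!$ for $0\le i,j\le p-1$ and $x^{(-1)}=y^{(-1)}=0$. Let $H=H(2;(1,1);\Phi(1))\subset W(2;(1,1))=\operatorname{Der}_k(O)$ be the non-graded Hamiltonian Lie algebra with basis $$y^{(j-1)}\partial_x-x^{(p-1)}y^{(j)}\partial_y,\qquad x^{(i-1)}y^{(j)}\partial_y-x^{(i)}y^{(j-1)}\partial_x\qquad(1\le i\le p-1,\ 0\le j\le p-1),$$ and let $\widehat H=H+k(x\partial_x+y\partial_y)$ be its minimal $p$-envelope, with $p$-map $D^{[p]}=D^p$. For $n\ge 0$ let $\widehat H_{(n)}=\{D\in\widehat H: D(O)\subseteq (x,y)^{n+1}\}$, so that $\widehat H_{(0)}/\widehat H_{(1)}\cong\mathfrak{gl}_2$. For $(a,b)\in\mathbb F_p^2$ let $L_0(a,b)$ be the simple restricted $\mathfrak{gl}_2$-module of highest weight $(a,b)$ (that is, with a nonzero vector killed by $x\partial_y$ on which $x\partial_x,y\partial_y$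 act by $a,b$), inflated to $\widehat H_{(0)}$; let $Z(a,b)=\mathfrak u(\widehat H)\otimes_{\mathfrak u(\widehat H_{(0)})}L_0(a,b)$, where $\mathfrak u$ denotes the restricted universal enveloping algebra, and let $L(a,b)$ be the quotient of $Z(a,b)$ by its unique maximal submodule. Theorem. Let $a\in\mathbb F_p$. The module $Z(a,a)$, which is induced from the one-dimensional module $L_0(a,a)$, is simple if and only if $a\ne 0$ and $a\ne p-1$. The module $Z(-1,-1)$ has exactly two composition factors, $L(-1,-1)$, of dimension $p^2-1$, and the trivial one-dimensional module. The module $Z(0,0)$ has exactly two composition factors, $L(0,-1)$, of dimension $p^2-1$, and the trivial one-dimensional module. -/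

import Mathlib

open scoped TensorProduct

noncomputable section

namespace HamiltonianModules

universe u

attribute [local instance 100] LieRing.ofAssociativeRing

/-! ### The truncated polynomial ring and its derivations -/

section TruncatedPolynomials

variable (p : ℕ) (k : Type u) [Field k]

/-- The ideal `(X ^ p, Y ^ p)` of `k[X, Y]`. -/
abbrev truncIdeal : Ideal (MvPolynomial (Fin 2) k) :=
  Ideal.span {MvPolynomial.X 0 ^ p, MvPolynomial.X 1 ^ p}

/-- The truncated polynomial ring `O(2; (1,1)) = k[X, Y] / (X ^ p, Y ^ p)`. -/
def Trunc : Type u := MvPolynomial (Fin 2) k ⧸ truncIdeal p k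

instance : CommRing (Trunc p k) :=
  inferInstanceAs (CommRing (MvPolynomial (Fin 2) k ⧸ truncIdeal p k))

instance : Algebra k (Trunc p k) :=
  inferInstanceAs (Algebra k (MvPolynomial (Fin 2) k ⧸ truncIdeal p k))

/-- The projection `k[X, Y] → k[X, Y] / (X ^ p, Y ^ p)`. -/
def truncMk : MvPolynomial (Fin 2) k →ₐ[k] Trunc p k :=
  Ideal.Quotient.mkₐ k (truncIdeal p k)

theorem truncMk_surjective : Function.Surjective (truncMk p k) :=
  Ideal.Quotient.mkₐ_surjective k _

theorem truncMk_eq_zero {f : MvPolynomial (Fin 2) k} : truncMk p k f = 0 ↔ f ∈ truncIdeal p k :=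
  Ideal.Quotient.eq_zero_iff_mem

/-- The Lie algebra `W(2; (1,1)) = Der (k[X, Y] / (X ^ p, Y ^ p))`. -/
abbrev Witt : Type u := Derivation k (Trunc p k) (Trunc p k)

/-- The image of `X` in the truncated polynomial ring. -/
def tx : Trunc p k := truncMk p k (MvPolynomial.X 0)

/-- The image of `Y` in the truncated polynomial ring. -/
def ty : Trunc p k := truncMk p k (MvPolynomial.X 1)

variable {p k} in
/-- The divided power `f ^ (n) = f ^ n / n!` (used only for `n < p`), with the convention that it
is zero for negative `n`. -/
def dpow (f : Trunc p k) (n : ℤ) : Trunc p k :=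
  if n < 0 then 0 else ((n.toNat.factorial : k)⁻¹) • f ^ n.toNat

theorem pderiv_mem_truncIdeal [CharP k p] (i : Fin 2) (f : MvPolynomial (Fin 2) k)
    (hf : truncMk p k f = 0) :
    truncMk p k (MvPolynomial.pderiv i f) = 0 := by
  have hp0 : (p : MvPolynomial (Fin 2) k) = 0 := CharP.cast_eq_zero _ p
  rw [truncMk_eq_zero] at hf ⊢
  induction hf using Submodule.span_induction with
  | mem g hg =>
    rcases hg with rfl | hg
    · rw [Derivation.leibniz_pow, ← Nat.cast_smul_eq_nsmul (MvPolynomial (Fin 2) k), hp0]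
      simp
    · rw [Set.mem_singleton_iff] at hg
      subst hg
      rw [Derivation.leibniz_pow, ← Nat.cast_smul_eq_nsmul (MvPolynomial (Fin 2) k), hp0]
      simp
  | zero => simp
  | add g h _ _ hg hh => rw [map_add]; exact Ideal.add_mem _ hg hh
  | smul r g hg' hg =>
    rw [smul_eq_mul, Derivation.leibniz]
    exact Ideal.add_mem _ (Ideal.mul_mem_left _ _ hg)
      (by rw [smul_eq_mul]; exact Ideal.mul_mem_right _ _ hg')

/-- The partial derivative of the truncated polynomial ring with respect to the `i`-th variable. -/
def partialD [CharP k p] (i : Fin 2) : Witt p k :=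
  Derivation.liftOfSurjective (f := truncMk p k) (truncMk_surjective p k) (d := MvPolynomial.pderiv i)
    (pderiv_mem_truncIdeal p k i)

/-- The maximal ideal `(x, y)`. -/
abbrev maxId : Ideal (Trunc p k) := Ideal.span {tx p k, ty p k}

/-- The nonnegative part of the descending filtration of `W(2; (1,1))` coming from the grading in
which `x ^ a y ^ b ∂` has degree `a + b - 1`: a derivation `f ∂x + g ∂y` lies in `W_(n)` iff `f` and
`g` lie in `(x, y) ^ (n + 1)`, i.e. iff it maps the whole ring into `(x, y) ^ (n + 1)`. -/
def wittFil (n : ℕ) : LieSubalgebra k (Witt p k) where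
  carrier := {D | ∀ f, D f ∈ maxId p k ^ (n + 1)}
  add_mem' := fun hD hE f => Ideal.add_mem _ (hD f) (hE f)
  zero_mem' := fun _ => Ideal.zero_mem _
  smul_mem' := fun c D hD f => by
    rw [Derivation.smul_apply]
    exact Submodule.smul_of_tower_mem _ c (hD f)
  lie_mem' := fun {D E} hD hE f => by
    rw [Derivation.commutator_apply]
    exact Ideal.sub_mem _ (hD _) (hE _)

/-! ### The Hamiltonian algebra and its minimal `p`-envelope -/

/-- The standard basis of the non-graded Hamiltonian algebra `H = H(2; (1,1); Φ(1))`, namely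
`y^(j-1) ∂x - x^(p-1) y^(j) ∂y` and `x^(i-1) y^(j) ∂y - x^(i) y^(j-1) ∂x` for
`1 ≤ i ≤ p - 1`, `0 ≤ j ≤ p - 1`. -/
def hamBasis [CharP k p] : Set (Witt p k) :=
  {D | ∃ j : ℤ, 0 ≤ j ∧ j ≤ (p : ℤ) - 1 ∧
      D = dpow (ty p k) (j - 1) • partialD p k 0
        - (dpow (tx p k) ((p : ℤ) - 1) * dpow (ty p k) j) • partialD p k 1} ∪
  {D | ∃ i j : ℤ, 1 ≤ i ∧ i ≤ (p : ℤ) - 1 ∧ 0 ≤ j ∧ j ≤ (p : ℤ) - 1 ∧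
      D = (dpow (tx p k) (i - 1) * dpow (ty p k) j) • partialD p k 1
        - (dpow (tx p k) i * dpow (ty p k) (j - 1)) • partialD p k 0}

/-- The minimal `p`-envelope `Ĥ` of `H`: the Lie subalgebra of `W(2; (1,1))` obtained from `H` by
adding `x ∂x + y ∂y`. (The linear span of these elements is already closed under the bracket, so
`lieSpan` adds nothing to it.) -/
def Hhat [CharP k p] : LieSubalgebra k (Witt p k) :=
  LieSubalgebra.lieSpan k (Witt p k)
    (hamBasis p k ∪ {tx p k • partialD p k 0 + ty p k • partialD p k 1})

/-- The subalgebra `Ĥ_(0) = Ĥ ∩ W_(0)`. -/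
def Hhat0 [CharP k p] : LieSubalgebra k (Witt p k) := Hhat p k ⊓ wittFil p k 0

theorem Hhat0_le_Hhat [CharP k p] : Hhat0 p k ≤ Hhat p k := inf_le_left

end TruncatedPolynomials

/-! ### Restricted enveloping algebras -/

section Restricted

variable (p : ℕ) {k : Type u} [Field k]

/-- The relations `D ^ p = D^[p]` in the enveloping algebra of a Lie algebra `L` of derivations,
where the `p`-map `D^[p]` is the `p`-fold composite of the derivation `D`. -/
inductive PRel {B : Type u} [CommRing B] [Algebra k B] (L : LieSubalgebra k (Derivation k B B)) :
    UniversalEnvelopingAlgebra k L → UniversalEnvelopingAlgebra k L → Prop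
  | of (D E : L) (h : ∀ f : B, (E : Derivation k B B) f = (⇑(D : Derivation k B B))^[p] f) :
      PRel L (UniversalEnvelopingAlgebra.ι k D ^ p) (UniversalEnvelopingAlgebra.ι k E)

/-- The restricted universal enveloping algebra `u(L)` of a restricted Lie algebra `L` of
derivations: the quotient of `U(L)` by the relations `D ^ p = D^[p]`. -/
abbrev ResEnv {B : Type u} [CommRing B] [Algebra k B] (L : LieSubalgebra k (Derivation k B B)) :
    Type u :=
  RingQuot (PRel p L)

/-- The canonical map `L → u(L)`. -/
def resι {B : Type u} [CommRing B] [Algebra k B] (L : LieSubalgebra k (Derivation k B B)) :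
    L →ₗ[k] ResEnv p L :=
  (RingQuot.mkAlgHom k (PRel p L)).toLinearMap ∘ₗ
    (UniversalEnvelopingAlgebra.ι k : L →ₗ⁅k⁆ UniversalEnvelopingAlgebra k L).toLinearMap

/-- The universal property of `u(L)`: a Lie homomorphism `ρ` to an associative algebra
with `ρ (D^[p]) = ρ(D) ^ p` extends to `u(L)`. -/
def resLift {B : Type u} [CommRing B] [Algebra k B] (L : LieSubalgebra k (Derivation k B B))
    {R : Type u} [Ring R] [Algebra k R] (ρ : L →ₗ⁅k⁆ R)
    (hρ : ∀ D E : L, (∀ f : B, (E : Derivation k B B) f = (⇑(D : Derivation k B B))^[p] f) →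
      ρ D ^ p = ρ E) : ResEnv p L →ₐ[k] R :=
  RingQuot.liftAlgHom k ⟨UniversalEnvelopingAlgebra.lift k ρ, by
    rintro _ _ ⟨D, E, h⟩
    rw [map_pow, UniversalEnvelopingAlgebra.lift_ι_apply,
      UniversalEnvelopingAlgebra.lift_ι_apply]
    exact hρ D E h⟩

/-- The algebra homomorphism `u(L) → u(L')` induced by an inclusion `L ≤ L'`. -/
def resIncl {B : Type u} [CommRing B] [Algebra k B] {L L' : LieSubalgebra k (Derivation k B B)}
    (h : L ≤ L') : ResEnv p L →ₐ[k] ResEnv p L' :=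
  RingQuot.liftAlgHom k ⟨(RingQuot.mkAlgHom k (PRel p L')).comp
      (UniversalEnvelopingAlgebra.lift k
        ((UniversalEnvelopingAlgebra.ι k).comp (LieSubalgebra.inclusion h))), by
    rintro _ _ ⟨D, E, hDE⟩
    simp only [AlgHom.comp_apply, map_pow, UniversalEnvelopingAlgebra.lift_ι_apply,
      LieHom.comp_apply]
    rw [← map_pow]
    exact RingQuot.mkAlgHom_rel k (PRel.of _ _ hDE)⟩

end Restricted

/-! ### Induced modules -/

section Induced

variable {k : Type u} [Field k] {S U : Type u} [Ring S] [Algebra k S] [Ring U] [Algebra k U]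
  {V : Type u} [AddCommGroup V] [Module k V]

/-- For an algebra homomorphism `φ : S → U` and a representation `ρ` of `S` on `V`, the
`U`-submodule of `U ⊗[k] V` spanned by the elements `u φ(s) ⊗ v - u ⊗ ρ(s) v`. -/
def balanced (φ : S →ₐ[k] U) (ρ : S →ₐ[k] Module.End k V) : Submodule U (U ⊗[k] V) :=
  Submodule.span U {t | ∃ (w : U) (s : S) (v : V), t = (w * φ s) ⊗ₜ[k] v - w ⊗ₜ[k] (ρ s v)}

/-- The induced module `U ⊗_S V`, with `U` acting by left multiplication. -/
abbrev Ind (φ : S →ₐ[k] U) (ρ : S →ₐ[k] Module.End k V) : Type u := (U ⊗[k] V) ⧸ balanced φ ρ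

end Induced

/-! ### The modules `L₀(a, b)` -/

section Simple

variable (p : ℕ) (k : Type u) [Field k]

/-- The powers of the maximal ideal, as `k`-subspaces. -/
abbrev maxPow (n : ℕ) : Submodule k (Trunc p k) := (maxId p k ^ n).restrictScalars k

/-- The space `(x, y) ^ n / (x, y) ^ (n + 1)`, that is, the space of homogeneous polynomials of
degree `n` in `x` and `y` when `n < p`. -/
abbrev Gr (n : ℕ) : Type u := maxPow p k n ⧸ (maxPow p k (n + 1)).submoduleOf (maxPow p k n)

variable {p k}

theorem wittFil_zero_maps {D : Witt p k} (hD : D ∈ wittFil p k 0) (n : ℕ) :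
    ∀ f ∈ maxPow p k n, (D : Trunc p k →ₗ[k] Trunc p k) f ∈ maxPow p k n := by
  intro f hf
  rw [Submodule.restrictScalars_mem] at hf ⊢
  rw [Derivation.coeFn_coe]
  induction n generalizing f with
  | zero => simp
  | succ n ih =>
    rw [pow_succ] at hf ⊢
    induction hf using Submodule.mul_induction_on' with
    | mem_mul_mem g hg h hh =>
      have h1 : D h ∈ maxId p k := by simpa using hD h
      rw [Derivation.leibniz, smul_eq_mul, smul_eq_mul, mul_comm h]
      exact Ideal.add_mem _ (Ideal.mul_mem_mul hg h1) (Ideal.mul_mem_mul (ih g hg) hh)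
    | add g _ h _ hg hh => rw [map_add]; exact Ideal.add_mem _ hg hh

/-- The action of `D ∈ W_(0)` on `(x, y) ^ n`. -/
def powAct (n : ℕ) (D : wittFil p k 0) : Module.End k (maxPow p k n) :=
  ((D : Witt p k) : Trunc p k →ₗ[k] Trunc p k).restrict (wittFil_zero_maps D.2 n)

theorem powAct_coe (n : ℕ) (D : wittFil p k 0) (f : maxPow p k n) :
    (powAct n D f : Trunc p k) = (D : Witt p k) f := rfl

theorem powAct_iterate_coe (n : ℕ) (D : wittFil p k 0) (m : ℕ) (f : maxPow p k n) :
    ((powAct n D ^ m) f : Trunc p k) = (⇑(D : Witt p k))^[m] f := by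
  induction m with
  | zero => rfl
  | succ m ih => rw [pow_succ', Module.End.mul_apply, powAct_coe, ih, Function.iterate_succ_apply']

/-- The action of `D ∈ W_(0)` on `(x, y) ^ n / (x, y) ^ (n + 1)`. -/
def grAct (n : ℕ) (D : wittFil p k 0) : Module.End k (Gr p k n) :=
  Submodule.mapQ _ _ (powAct n D) (fun f hf => wittFil_zero_maps D.2 (n + 1) f hf)

theorem grAct_mk (n : ℕ) (D : wittFil p k 0) (f : maxPow p k n) :
    grAct n D (Submodule.Quotient.mk f) = Submodule.Quotient.mk (powAct n D f) := rfl

theorem grAct_pow_mk (n : ℕ) (D : wittFil p k 0) (m : ℕ) (f : maxPow p k n) :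
    (grAct n D ^ m) (Submodule.Quotient.mk f) = Submodule.Quotient.mk ((powAct n D ^ m) f) := by
  induction m with
  | zero => rfl
  | succ m ih => rw [pow_succ', Module.End.mul_apply, ih, grAct_mk, pow_succ', Module.End.mul_apply]

/-- The action of `W_(0)` on `(x, y) ^ n / (x, y) ^ (n + 1)`, as a Lie homomorphism. -/
def grHom (n : ℕ) : wittFil p k 0 →ₗ⁅k⁆ Module.End k (Gr p k n) where
  toFun := grAct n
  map_add' D E := by
    ext f
    rfl
  map_smul' c D := by
    ext f
    rfl
  map_lie' {D E} := by
    ext f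
    rfl

/-- The trace of the linear part of `D ∈ W_(0)`, i.e. of its action on `(x, y) / (x, y) ^ 2`. -/
def linTrace (D : wittFil p k 0) : k := LinearMap.trace k (Gr p k 1) (grHom 1 D)

open Matrix in
theorem matrix_trace_pow_char [Fact p.Prime] [CharP k p] {n : Type*} [Fintype n] [DecidableEq n]
    (M : Matrix n n k) : (M ^ p).trace = M.trace ^ p := by
  have hp : 0 < p := (Fact.out : p.Prime).pos
  cases isEmpty_or_nonempty n
  · simp [Matrix.trace, hp.ne']
  have key : Polynomial.expand k p (M ^ p).charpoly = M.charpoly ^ p := by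
    unfold charpoly
    rw [AlgHom.map_det, ← coe_detMonoidHom, ← (detMonoidHom : Matrix n n (Polynomial k) →* _).map_pow]
    apply congr_arg det
    refine matPolyEquiv.injective ?_
    rw [map_pow, matPolyEquiv_charmatrix, sub_pow_char_of_commute, ← Polynomial.C_pow]
    · exact matPolyEquiv_eq_X_pow_sub_C p M
    · exact (Polynomial.C M).commute_X
  rw [← Polynomial.map_frobenius_expand p, Polynomial.map_expand] at key
  have key2 := Polynomial.expand_injective hp key
  have h2 := congr_arg (fun f => f.coeff (Fintype.card n - 1)) key2
  simp only [Polynomial.coeff_map, frobenius_def] at h2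
  rw [Matrix.trace_eq_neg_charpoly_coeff, Matrix.trace_eq_neg_charpoly_coeff, h2,
    ← frobenius_def, ← frobenius_def, map_neg]

theorem end_trace_pow_char [Fact p.Prime] [CharP k p] {V : Type*} [AddCommGroup V] [Module k V]
    (T : Module.End k V) : LinearMap.trace k V (T ^ p) = LinearMap.trace k V T ^ p := by
  classical
  by_cases h : ∃ s : Finset V, Nonempty (Module.Basis s k V)
  · obtain ⟨s, ⟨b⟩⟩ := h
    have h1 : LinearMap.toMatrix b b (T ^ p) = LinearMap.toMatrix b b T ^ p := by
      have := map_pow (LinearMap.toMatrixAlgEquiv b) T p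
      exact this
    rw [LinearMap.trace_eq_matrix_trace k b, LinearMap.trace_eq_matrix_trace k b,
      h1, matrix_trace_pow_char]
  · simp [LinearMap.trace, h, (Fact.out : p.Prime).ne_zero]

theorem add_smul_one_pow [Fact p.Prime] [CharP k p] {V : Type*} [AddCommGroup V] [Module k V]
    (T : Module.End k V) (c : k) :
    (T + c • (1 : Module.End k V)) ^ p = T ^ p + c ^ p • (1 : Module.End k V) := by
  have hc : Commute T (c • (1 : Module.End k V)) := (Commute.one_right T).smul_right c
  obtain ⟨r, hr⟩ := hc.exists_add_pow_prime_eq (Fact.out : p.Prime)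
  have h0 : (p : Module.End k V) = 0 := by
    rw [← map_natCast (algebraMap k (Module.End k V)), CharP.cast_eq_zero, map_zero]
  rw [hr, h0, smul_pow, one_pow]
  simp

/-- The action of `W_(0)` on `(x, y) ^ n / (x, y) ^ (n + 1)`, twisted by `c` times the trace of the
linear part. -/
def twistHom (n : ℕ) (c : k) : wittFil p k 0 →ₗ⁅k⁆ Module.End k (Gr p k n) where
  toFun D := grHom n D + (c * linTrace D) • (1 : Module.End k (Gr p k n))
  map_add' D E := by
    simp only [linTrace, map_add, mul_add, add_smul]
    abel
  map_smul' r D := by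
    simp only [linTrace, map_smul, smul_add, smul_smul, smul_eq_mul, RingHom.id_apply]
    rw [mul_left_comm]
  map_lie' {D E} := by
    have h0 : linTrace ⁅D, E⁆ = 0 := by
      rw [linTrace, LieHom.map_lie, LieRing.of_associative_ring_bracket, map_sub,
        LinearMap.trace_mul_comm, sub_self]
    simp only [h0, mul_zero, zero_smul, add_zero, LieHom.map_lie,
      LieRing.of_associative_ring_bracket, add_mul, mul_add, smul_mul_assoc, mul_smul_comm,
      one_mul, mul_one, smul_add]
    rw [smul_comm (c * linTrace D) (c * linTrace E)]
    abel

theorem grHom_pow {n : ℕ} {D E : wittFil p k 0}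
    (h : ∀ f : Trunc p k, (E : Witt p k) f = (⇑(D : Witt p k))^[p] f) :
    grHom n D ^ p = grHom n E := by
  refine LinearMap.ext fun f => ?_
  obtain ⟨f, rfl⟩ := Submodule.Quotient.mk_surjective _ f
  change (grAct n D ^ p) _ = grAct n E _
  rw [grAct_pow_mk, grAct_mk]
  congr 1
  apply Subtype.ext
  rw [powAct_iterate_coe, powAct_coe, h]

theorem twistHom_pow [Fact p.Prime] [CharP k p] {n : ℕ} {c : k} (hc : c ^ p = c)
    {D E : wittFil p k 0} (h : ∀ f : Trunc p k, (E : Witt p k) f = (⇑(D : Witt p k))^[p] f) :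
    twistHom n c D ^ p = twistHom n c E := by
  change (grHom n D + (c * linTrace D) • (1 : Module.End k (Gr p k n))) ^ p
    = grHom n E + (c * linTrace E) • (1 : Module.End k (Gr p k n))
  rw [add_smul_one_pow, grHom_pow h, mul_pow, hc, linTrace, linTrace, ← end_trace_pow_char,
    grHom_pow h]

variable (p k) [Fact p.Prime] [CharP k p]

/-- The restricted Lie representation of `Ĥ_(0)` on `(x, y) ^ n / (x, y) ^ (n + 1)` given by the
action of derivations, twisted by `b` times the trace of the linear part. -/
def simpleHom (n : ℕ) (b : ZMod p) : Hhat0 p k →ₗ⁅k⁆ Module.End k (Gr p k n) :=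
  (twistHom n (ZMod.castHom dvd_rfl k b)).comp (LieSubalgebra.inclusion inf_le_right)

/-- The simple restricted module `L₀(a, b)` of highest weight `(a, b) ∈ 𝔽_p²` for
`Ĥ_(0) / Ĥ_(1) ≅ 𝔤𝔩₂`, inflated to `u(Ĥ_(0))`. With `n ∈ {0, …, p - 1}` congruent to `a - b`, it is
`Symⁿ(V) ⊗ det ^ b` for the natural module `V = (x, y) / (x, y) ^ 2`, that is, the space
`(x, y) ^ n / (x, y) ^ (n + 1)` of homogeneous polynomials of degree `n`, on which `D` acts
as a derivation plus `b` times the trace of its linear part. The vector `x ^ n` is annihilated by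
`x ∂y`, and `x ∂x`, `y ∂y` act on it by `n + b = a` and `b`. -/
def simpleRep (a b : ZMod p) : ResEnv p (Hhat0 p k) →ₐ[k] Module.End k (Gr p k (a - b).val) :=
  resLift p (Hhat0 p k) (simpleHom p k (a - b).val b) fun D E h =>
    twistHom_pow (by rw [← map_pow, ZMod.pow_card])
      (D := LieSubalgebra.inclusion inf_le_right D) (E := LieSubalgebra.inclusion inf_le_right E) h

/-- The algebra `u(Ĥ)`. -/
abbrev UHat : Type u := ResEnv p (Hhat p k)

/-- The induced module `Z(a, b) = u(Ĥ) ⊗_{u(Ĥ_(0))} L₀(a, b)`. -/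
abbrev Z (a b : ZMod p) : Type u := Ind (resIncl p (Hhat0_le_Hhat p k)) (simpleRep p k a b)

/-- The module `L(a, b)`, the quotient of `Z(a, b)` by its unique maximal submodule
(the intersection of all maximal submodules). -/
abbrev L (a b : ZMod p) : Type u := Z p k a b ⧸ Module.jacobson (UHat p k) (Z p k a b)

/-- The underlying space `k` of the trivial `Ĥ`-module. -/
def Triv (_p : ℕ) (k : Type u) : Type u := k

instance : AddCommGroup (Triv p k) := inferInstanceAs (AddCommGroup k)

/-- The augmentation `u(Ĥ) → k`, which sends every element of `Ĥ` to zero. -/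
def augmentation : UHat p k →ₐ[k] k :=
  resLift p (Hhat p k) (0 : Hhat p k →ₗ⁅k⁆ k) fun D E _ => by
    simp [(Fact.out : p.Prime).ne_zero]

/-- The trivial one-dimensional `Ĥ`-module. -/
instance : Module (UHat p k) (Triv p k) :=
  Module.compHom k (augmentation p k).toRingHom

end Simple

/-- `M` has a composition series with exactly two factors, isomorphic to `A` and `B` in some
order. -/
def HasCompositionFactors (R : Type u) [Ring R] (M A B : Type u) [AddCommGroup M] [Module R M]
    [AddCommGroup A] [Module R A] [AddCommGroup B] [Module R B] : Prop :=
  IsSimpleModule R A ∧ IsSimpleModule R B ∧ ∃ N : Submodule R M,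
    (Nonempty (N ≃ₗ[R] A) ∧ Nonempty ((M ⧸ N) ≃ₗ[R] B)) ∨
    (Nonempty (N ≃ₗ[R] B) ∧ Nonempty ((M ⧸ N) ≃ₗ[R] A))

end HamiltonianModules

end

/-! The induced modules are realised inside the de Rham complex. For `c` in the prime field let a
derivation `D` act on `O` by `f ↦ D f + c div(D) f`; this is the module of densities of weight `c`,
with functions at `c = 0` and 2-forms at `c = 1`. Put `τ = x^(p-1) y^(p-1)`. Since `τ` kills the
maximal ideal, `D τ = -tr(D) τ` for `D` in `W_(0)`, where `tr` is the trace of the linear part. So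
the line through `τ` in weight `a + 1` is a copy of `L₀(a, a)`, and `Z(a, a)` maps to the densities
of weight `a + 1`.

This map is onto because `∂y` and `A = hamA p k 1` lower `τ` to every monomial. It is bijective by
counting: `Ĥ = Ĥ_(0) + k A + k ∂y` with `∂y^p = 0` and `A^p = -y ∂y ∈ Ĥ_(0)`, so `dim Z(a, a) ≤ p²`
(`nonempty_equiv_dens`). In the same way `Z(0, -1)` is the module of 1-forms, generated by `τ dx`
and `τ dy` (`nonempty_equiv_forms`).

For submodules, the weights of `x ∂x` and `y ∂y` separate monomials, so a nonzero submodule of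
densities contains a monomial and, after lowering, contains `1`. The operator `hamA p k j` sends
`y^b` to `b + c j` times a nonzero multiple of `x^(p-1) y^(b+j-1)`. With `j = p - 1` this leads from
`1` to `x^(p-1) y^(p-2)` if `c ≠ 0`, and from `y` to `τ` if `c ≠ 1`. Hence the densities are simple
for `c ≠ 0, 1` (`DensStable.eq_bot_or_eq_top`).

At `c = 0` the constants are the greatest proper submodule, which gives `Z(-1, -1)`. At `c = 1` the
coefficient of `τ` is a map onto the trivial module whose kernel lies in every nonzero submodule.
That kernel is the image of the 1-forms under `d` (`range_dOneHom`). As `ker d` is the greatest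
proper submodule of the 1-forms (`FormStable.eq_top_of_not_le_ker`), the image of `d` is `L(0, -1)`,
which gives `Z(0, 0)`. -/

noncomputable section

namespace HamiltonianModules

universe u

attribute [local instance 100] LieRing.ofAssociativeRing

/-! ### The monomial basis of the truncated polynomial ring. -/

section TruncBasics

variable (p : ℕ) (k : Type u) [Field k]

theorem tx_pow_char : tx p k ^ p = 0 := by
  rw [tx, ← map_pow, truncMk_eq_zero]
  exact Ideal.subset_span (by simp)

theorem ty_pow_char : ty p k ^ p = 0 := by
  rw [ty, ← map_pow, truncMk_eq_zero]
  exact Ideal.subset_span (by simp)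

theorem adjoin_tx_ty : Algebra.adjoin k {tx p k, ty p k} = ⊤ := by
  have h := congrArg (Subalgebra.map (truncMk p k))
    (MvPolynomial.adjoin_range_X (R := k) (σ := Fin 2))
  rw [AlgHom.map_adjoin, Algebra.map_top, (AlgHom.range_eq_top _).2 (truncMk_surjective p k),
    ← Set.range_comp] at h
  rw [← h]
  congr 1
  ext f
  simp [Fin.exists_fin_two, tx, ty, eq_comm]

variable {p k}

theorem witt_ext {D E : Witt p k} (hx : D (tx p k) = E (tx p k)) (hy : D (ty p k) = E (ty p k)) :
    D = E := by
  refine Derivation.ext_of_adjoin_eq_top _ (adjoin_tx_ty p k) ?_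
  rintro f (rfl | rfl)
  · exact hx
  · exact hy

theorem tx_pow_eq_zero {n : ℕ} (h : p ≤ n) : tx p k ^ n = 0 := by
  rw [← Nat.sub_add_cancel h, pow_add, tx_pow_char, mul_zero]

theorem ty_pow_eq_zero {n : ℕ} (h : p ≤ n) : ty p k ^ n = 0 := by
  rw [← Nat.sub_add_cancel h, pow_add, ty_pow_char, mul_zero]

theorem truncMk_monomial (s : Fin 2 →₀ ℕ) (c : k) :
    truncMk p k (MvPolynomial.monomial s c) = c • (tx p k ^ s 0 * ty p k ^ s 1) := by
  rw [MvPolynomial.monomial_eq, Finsupp.prod_fintype _ _ (by simp), Fin.prod_univ_two,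
    ← MvPolynomial.smul_eq_C_mul, map_smul, map_mul, map_pow, map_pow, tx, ty]

variable (p k)

/-- The monomials `x ^ i * y ^ j` with `i, j < p`. -/
def mono (ij : Fin p × Fin p) : Trunc p k := tx p k ^ (ij.1 : ℕ) * ty p k ^ (ij.2 : ℕ)

theorem span_mono : Submodule.span k (Set.range (mono p k)) = ⊤ := by
  rw [eq_top_iff]
  rintro f -
  obtain ⟨f, rfl⟩ := truncMk_surjective p k f
  induction f using MvPolynomial.induction_on' with
  | monomial s c =>
    rw [truncMk_monomial]
    refine Submodule.smul_mem _ _ ?_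
    by_cases h0 : s 0 < p
    · by_cases h1 : s 1 < p
      · exact Submodule.subset_span ⟨(⟨s 0, h0⟩, ⟨s 1, h1⟩), rfl⟩
      · simp [ty_pow_eq_zero (not_lt.1 h1)]
    · simp [tx_pow_eq_zero (not_lt.1 h0)]
  | add f g hf hg => rw [map_add]; exact Submodule.add_mem _ hf hg

/-- The exponent vector `(i, j)`. -/
def expo (ij : Fin p × Fin p) : Fin 2 →₀ ℕ := Finsupp.equivFunOnFinite.symm ![ij.1, ij.2]

theorem expo_injective : Function.Injective (expo p) := by
  intro a b h
  have h0 := DFunLike.congr_fun h 0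
  have h1 := DFunLike.congr_fun h 1
  simp only [expo, Finsupp.equivFunOnFinite_symm_apply_apply, Matrix.cons_val_zero, Matrix.cons_val_one,
    Matrix.cons_val_fin_one] at h0 h1
  exact Prod.ext (Fin.ext h0) (Fin.ext h1)

theorem mono_eq (ij : Fin p × Fin p) :
    mono p k ij = truncMk p k (MvPolynomial.monomial (expo p ij) 1) := by
  rw [truncMk_monomial, one_smul]
  simp [mono, expo]

/-- The ideal is generated by monomials, so membership can be read off the support. Independence of
the monomials with both exponents below `p` follows. -/
theorem mem_truncIdeal {f : MvPolynomial (Fin 2) k} (hf : f ∈ truncIdeal p k) {s : Fin 2 →₀ ℕ}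
    (hs : s ∈ f.support) : p ≤ s 0 ∨ p ≤ s 1 := by
  have h : truncIdeal p k = Ideal.span ((fun s => MvPolynomial.monomial s (1 : k)) ''
      {Finsupp.single 0 p, Finsupp.single 1 p}) := by
    rw [Set.image_pair, truncIdeal]
    simp [MvPolynomial.X_pow_eq_monomial]
  rw [h, MvPolynomial.mem_ideal_span_monomial_image] at hf
  obtain ⟨t, ht, hle⟩ := hf s hs
  rcases ht with rfl | rfl
  · left; simpa using hle 0
  · right; simpa using hle 1

theorem linearIndependent_mono : LinearIndependent k (mono p k) := by
  rw [Fintype.linearIndependent_iff]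
  intro g hg ij
  have h1 : truncMk p k (∑ i, MvPolynomial.monomial (expo p i) (g i)) = 0 := by
    rw [map_sum, ← hg]
    refine Finset.sum_congr rfl fun i _ => ?_
    rw [mono_eq, ← map_smul, MvPolynomial.smul_monomial, smul_eq_mul, mul_one]
  rw [truncMk_eq_zero] at h1
  by_contra hne
  have hc : (∑ i, MvPolynomial.monomial (expo p i) (g i)).coeff (expo p ij) = g ij := by
    rw [MvPolynomial.coeff_sum, Finset.sum_eq_single ij]
    · simp
    · intro b _ hb
      rw [MvPolynomial.coeff_monomial, if_neg fun h => hb (expo_injective p h)]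
    · simp
  have := mem_truncIdeal p k h1 (s := expo p ij) (by rwa [MvPolynomial.mem_support_iff, hc])
  simp [expo] at this
  have := ij.1.2
  have := ij.2.2
  omega

/-- The monomial basis of the truncated polynomial ring. -/
def monoBasis : Module.Basis (Fin p × Fin p) k (Trunc p k) :=
  Module.Basis.mk (linearIndependent_mono p k) (span_mono p k).ge

@[simp] theorem monoBasis_apply (ij : Fin p × Fin p) : monoBasis p k ij = mono p k ij := by
  simp [monoBasis]

theorem finrank_trunc : Module.finrank k (Trunc p k) = p ^ 2 := by
  rw [Module.finrank_eq_card_basis (monoBasis p k)]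
  simp [sq]

instance : Module.Finite k (Trunc p k) := Module.Finite.of_basis (monoBasis p k)

variable {p k}

/-- A `k`-subspace containing all monomials is everything. -/
theorem eq_top_of_monomials {M : Submodule k (Trunc p k)}
    (h : ∀ i < p, ∀ j < p, tx p k ^ i * ty p k ^ j ∈ M) : M = ⊤ := by
  rw [eq_top_iff, ← span_mono, Submodule.span_le]
  rintro _ ⟨⟨i, j⟩, rfl⟩
  exact h i i.2 j j.2

theorem monomial_ne_zero {i j : ℕ} (hi : i < p) (hj : j < p) : tx p k ^ i * ty p k ^ j ≠ 0 :=
  by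
  simpa [mono] using (linearIndependent_mono p k).ne_zero (⟨i, hi⟩, ⟨j, hj⟩)

/-- Linear maps on the truncated polynomial ring agree if they agree on monomials. -/
theorem linearMap_ext_monomials {V : Type*} [AddCommGroup V] [Module k V]
    {f g : Trunc p k →ₗ[k] V}
    (h : ∀ i < p, ∀ j < p, f (tx p k ^ i * ty p k ^ j) = g (tx p k ^ i * ty p k ^ j)) : f = g := by
  refine (monoBasis p k).ext fun ij => ?_
  rw [monoBasis_apply]
  exact h _ ij.1.2 _ ij.2.2

end TruncBasics

/-! ### Partial derivatives on monomials. -/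

section Derivations

variable {p : ℕ} {k : Type u} [Field k] [CharP k p]

@[simp] theorem partialD_zero_tx : partialD p k 0 (tx p k) = 1 := by
  simp [partialD, tx]
@[simp] theorem partialD_zero_ty : partialD p k 0 (ty p k) = 0 := by
  simp [partialD, ty]
@[simp] theorem partialD_one_tx : partialD p k 1 (tx p k) = 0 := by
  simp [partialD, tx]
@[simp] theorem partialD_one_ty : partialD p k 1 (ty p k) = 1 := by
  simp [partialD, ty]

theorem witt_eq (D : Witt p k) :
    D = D (tx p k) • partialD p k 0 + D (ty p k) • partialD p k 1 :=
  witt_ext (by simp) (by simp)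

theorem witt_apply (D : Witt p k) (f : Trunc p k) :
    D f = D (tx p k) * partialD p k 0 f + D (ty p k) * partialD p k 1 f := by
  conv_lhs => rw [witt_eq D]
  simp

theorem partialD_comm (f : Trunc p k) :
    partialD p k 0 (partialD p k 1 f) = partialD p k 1 (partialD p k 0 f) := by
  have h : ⁅partialD p k 0, partialD p k 1⁆ = 0 :=
    witt_ext (by simp [Derivation.commutator_apply]) (by simp [Derivation.commutator_apply])
  have := DFunLike.congr_fun h f
  rwa [Derivation.commutator_apply, Derivation.zero_apply, sub_eq_zero] at this

theorem partialD_zero_monomial (i j : ℕ) :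
    partialD p k 0 (tx p k ^ i * ty p k ^ j) = (i : k) • (tx p k ^ (i - 1) * ty p k ^ j) := by
  simp [Derivation.leibniz, Derivation.leibniz_pow, Nat.cast_smul_eq_nsmul]
  ring

theorem partialD_one_monomial (i j : ℕ) :
    partialD p k 1 (tx p k ^ i * ty p k ^ j) = (j : k) • (tx p k ^ i * ty p k ^ (j - 1)) := by
  simp [Derivation.leibniz, Derivation.leibniz_pow, Nat.cast_smul_eq_nsmul]
  ring

end Derivations

/-! ### Frobenius and Leibniz rules. -/

section Leibniz

variable (p : ℕ) [Fact p.Prime] {k : Type u} [Field k] [CharP k p]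

theorem add_pow_char_of_commute_end {V : Type*} [AddCommGroup V] [Module k V]
    {S T : Module.End k V} (h : Commute S T) : (S + T) ^ p = S ^ p + T ^ p := by
  obtain ⟨r, hr⟩ := h.exists_add_pow_prime_eq (Fact.out : p.Prime)
  have h0 : (p : Module.End k V) = 0 := by
    rw [← map_natCast (algebraMap k (Module.End k V)), CharP.cast_eq_zero, map_zero]
  rw [hr, h0]
  simp

/-- In characteristic `p`, the `p`-th power of an operator satisfying a Leibniz rule
satisfies the Leibniz rule for the `p`-th powers. -/
theorem leibniz_pow_char {A B C : Type*} [AddCommGroup A] [Module k A] [AddCommGroup B]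
    [Module k B] [AddCommGroup C] [Module k C] (β : A →ₗ[k] B →ₗ[k] C) {S : Module.End k A}
    {T : Module.End k B} {R : Module.End k C}
    (h : ∀ a b, R (β a b) = β (S a) b + β a (T b)) (a : A) (b : B) :
    (R ^ p) (β a b) = β ((S ^ p) a) b + β a ((T ^ p) b) := by
  -- Through `β`, the operator `R` corresponds to `S ⊗ 1 + 1 ⊗ T` on `A ⊗ B`. The two summands
  -- commute, so the mixed terms of the `p`-th power vanish.
  have hcomm : Commute (LinearMap.rTensor B S) (LinearMap.lTensor A T) := by
    refine TensorProduct.ext' fun x y => ?_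
    simp
  have key : ∀ n : ℕ, ∀ t : A ⊗[k] B, (R ^ n) (TensorProduct.lift β t) =
      TensorProduct.lift β (((LinearMap.rTensor B S + LinearMap.lTensor A T) ^ n) t) := by
    intro n
    induction n with
    | zero => intro t; rfl
    | succ n ih =>
      intro t
      rw [pow_succ, pow_succ, Module.End.mul_apply, Module.End.mul_apply, ← ih]
      congr 1
      induction t with
      | zero => simp
      | tmul x y => simp [h]
      | add x y hx hy => simp only [map_add, hx, hy]
  have := key p (a ⊗ₜ b)
  rw [add_pow_char_of_commute_end p hcomm, LinearMap.rTensor_pow, LinearMap.lTensor_pow] at this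
  simpa using this

end Leibniz

/-! ### Restricted enveloping algebras: generators and induction. -/

section ResEnv

variable {p : ℕ} {k : Type u} [Field k] {B : Type u} [CommRing B] [Algebra k B]
  {L : LieSubalgebra k (Derivation k B B)}

@[simp] theorem resLift_resι {R : Type u} [Ring R] [Algebra k R] (ρ : L →ₗ⁅k⁆ R)
    (hρ : ∀ D E : L, (∀ f : B, (E : Derivation k B B) f = (⇑(D : Derivation k B B))^[p] f) →
      ρ D ^ p = ρ E) (D : L) : resLift p L ρ hρ (resι p L D) = ρ D := by
  rw [resLift, resι, LinearMap.comp_apply, AlgHom.toLinearMap_apply,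
    RingQuot.liftAlgHom_mkAlgHom_apply]
  exact UniversalEnvelopingAlgebra.lift_ι_apply k ρ D

@[simp] theorem resIncl_resι {L' : LieSubalgebra k (Derivation k B B)} (h : L ≤ L') (D : L) :
    resIncl p h (resι p L D) = resι p L' (LieSubalgebra.inclusion h D) := by
  rw [resIncl, resι, LinearMap.comp_apply, AlgHom.toLinearMap_apply,
    RingQuot.liftAlgHom_mkAlgHom_apply, AlgHom.comp_apply]
  exact congrArg (RingQuot.mkAlgHom k (PRel p L')) (UniversalEnvelopingAlgebra.lift_ι_apply k
    ((UniversalEnvelopingAlgebra.ι k).comp (LieSubalgebra.inclusion h)) D)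

theorem resι_lie (D E : L) :
    resι p L ⁅D, E⁆ = resι p L D * resι p L E - resι p L E * resι p L D := by
  simp only [resι, LinearMap.comp_apply, AlgHom.toLinearMap_apply, LieHom.coe_toLinearMap,
    LieHom.map_lie, LieRing.of_associative_ring_bracket, map_sub, map_mul]

theorem resι_pow {D E : L}
    (h : ∀ f : B, (E : Derivation k B B) f = (⇑(D : Derivation k B B))^[p] f) :
    resι p L D ^ p = resι p L E := by
  simp only [resι, LinearMap.comp_apply, AlgHom.toLinearMap_apply, LieHom.coe_toLinearMap]
  refine (map_pow _ _ _).symm.trans ?_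
  exact RingQuot.mkAlgHom_rel k (s := PRel p L) (PRel.of D E h)

theorem adjoin_range_resι : Algebra.adjoin k (Set.range (resι p L)) = ⊤ := by
  have h := congrArg (Subalgebra.map
    ((RingQuot.mkAlgHom k (PRel p L)).comp (UniversalEnvelopingAlgebra.mkAlgHom k L)))
    (TensorAlgebra.adjoin_range_ι (R := k) (M := L))
  have hs : Function.Surjective (UniversalEnvelopingAlgebra.mkAlgHom k L) :=
    (UniversalEnvelopingAlgebra.ringCon k L).mk'_surjective
  have ht := (AlgHom.range_eq_top
    ((RingQuot.mkAlgHom k (PRel p L)).comp (UniversalEnvelopingAlgebra.mkAlgHom k L))).2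
    ((RingQuot.mkAlgHom_surjective k _).comp hs)
  rw [AlgHom.map_adjoin, Algebra.map_top, ht, ← Set.range_comp] at h
  rw [← h]
  rfl

theorem resEnv_induction {P : ResEnv p L → Prop} (hc : ∀ c : k, P (algebraMap k _ c))
    (hι : ∀ D : L, P (resι p L D)) (hadd : ∀ x y, P x → P y → P (x + y))
    (hmul : ∀ x y, P x → P y → P (x * y)) (x : ResEnv p L) : P x := by
  have hx : x ∈ Algebra.adjoin k (Set.range (resι p L)) := by
    rw [adjoin_range_resι]; trivial
  induction hx using Algebra.adjoin_induction with
  | mem x hx => obtain ⟨D, rfl⟩ := hx; exact hι D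
  | algebraMap c => exact hc c
  | add x y _ _ hx hy => exact hadd x y hx hy
  | mul x y _ _ hx hy => exact hmul x y hx hy

variable {M M' : Type*} [AddCommGroup M] [Module k M] [Module (ResEnv p L) M]
  [IsScalarTower k (ResEnv p L) M] [AddCommGroup M'] [Module k M'] [Module (ResEnv p L) M']
  [IsScalarTower k (ResEnv p L) M']

/-- A linear map commuting with the Lie algebra is linear over the restricted
enveloping algebra. -/
def equivariantMap (f : M →ₗ[k] M') (h : ∀ (D : L) (m : M), f (resι p L D • m) = resι p L D • f m) :
    M →ₗ[ResEnv p L] M' where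
  toFun := f
  map_add' := f.map_add
  map_smul' u := by
    simp only [RingHom.id_apply]
    induction u using resEnv_induction with
    | hc c => intro m; rw [algebraMap_smul, map_smul, algebraMap_smul]
    | hι D => exact h D
    | hadd x y hx hy => intro m; rw [add_smul, map_add, hx, hy, add_smul]
    | hmul x y hx hy => intro m; rw [mul_smul, hx, hy, mul_smul]

/-- A subspace stable under the Lie algebra, as a submodule over the restricted enveloping
algebra. -/
def stableSubmodule (P : Submodule k M) (h : ∀ (D : L), ∀ m ∈ P, resι p L D • m ∈ P) :
    Submodule (ResEnv p L) M where
  carrier := P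
  add_mem' := P.add_mem
  zero_mem' := P.zero_mem
  smul_mem' u := by
    induction u using resEnv_induction with
    | hc c => intro m hm; rw [algebraMap_smul]; exact P.smul_mem c hm
    | hι D => exact fun {m} => h D m
    | hadd x y hx hy => intro m hm; rw [add_smul]; exact P.add_mem (hx hm) (hy hm)
    | hmul x y hx hy => intro m hm; rw [mul_smul]; exact hx (hy hm)

end ResEnv

/-! ### Modules from representations. -/

section RepMod

variable {k : Type u} [Field k] {U V : Type u} [Ring U] [Algebra k U] [AddCommGroup V] [Module k V]

/-- The vector space `V` considered as a module via a representation `ρ : U → End V`. -/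
def RepMod (_ρ : U →ₐ[k] Module.End k V) : Type u := V

variable (ρ : U →ₐ[k] Module.End k V)

instance : AddCommGroup (RepMod ρ) := inferInstanceAs (AddCommGroup V)

instance : Module k (RepMod ρ) := inferInstanceAs (Module k V)

instance : Module U (RepMod ρ) := Module.compHom V ρ.toRingHom

/-- The identity map from `V` to the module `RepMod ρ`. -/
def toRepMod : V ≃ₗ[k] RepMod ρ := LinearEquiv.refl k V

variable {ρ}

theorem smul_toRepMod (u : U) (v : V) : u • toRepMod ρ v = toRepMod ρ (ρ u v) := rfl

theorem toRepMod_symm_smul (u : U) (m : RepMod ρ) :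
    (toRepMod ρ).symm (u • m) = ρ u ((toRepMod ρ).symm m) := rfl

instance : IsScalarTower k U (RepMod ρ) := ⟨fun c u m => by
  apply (toRepMod ρ).symm.injective
  rw [toRepMod_symm_smul, map_smul, map_smul, toRepMod_symm_smul]
  rfl⟩

/-- A submodule of `RepMod ρ` as a subspace of `V`. -/
def subspaceOf (M : Submodule U (RepMod ρ)) : Submodule k V :=
  (M.restrictScalars k).comap (toRepMod ρ).toLinearMap

theorem mem_subspaceOf {M : Submodule U (RepMod ρ)} {v : V} :
    v ∈ subspaceOf M ↔ toRepMod ρ v ∈ M := Iff.rfl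

theorem subspaceOf_stable {M : Submodule U (RepMod ρ)} {v : V} (u : U) (h : v ∈ subspaceOf M) :
    ρ u v ∈ subspaceOf M := M.smul_mem u h

theorem subspaceOf_eq_top {M : Submodule U (RepMod ρ)} : subspaceOf M = ⊤ ↔ M = ⊤ := by
  rw [eq_top_iff, eq_top_iff]
  exact ⟨fun h m _ => h (x := (toRepMod ρ).symm m) trivial, fun h m _ => h (x := toRepMod ρ m) trivial⟩

theorem subspaceOf_eq_bot {M : Submodule U (RepMod ρ)} : subspaceOf M = ⊥ ↔ M = ⊥ := by
  rw [eq_bot_iff, eq_bot_iff]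
  exact ⟨fun h m hm => h (x := (toRepMod ρ).symm m) hm, fun h m hm => h (x := toRepMod ρ m) hm⟩

end RepMod

/-! ### The universal property of induced modules. -/

section Induced

variable {k : Type u} [Field k] {S U : Type u} [Ring S] [Algebra k S] [Ring U] [Algebra k U]
  {V : Type u} [AddCommGroup V] [Module k V] (φ : S →ₐ[k] U) (ρ : S →ₐ[k] Module.End k V)

/-- The canonical map from `V` to the induced module. -/
def indι : V →ₗ[k] Ind φ ρ :=
  ((balanced φ ρ).mkQ.restrictScalars k) ∘ₗ TensorProduct.mk k U V 1

theorem smul_indι (s : S) (v : V) : φ s • indι φ ρ v = indι φ ρ (ρ s v) := by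
  change φ s • (balanced φ ρ).mkQ _ = (balanced φ ρ).mkQ _
  rw [← map_smul, ← sub_eq_zero, ← map_sub, Submodule.mkQ_apply, Submodule.Quotient.mk_eq_zero]
  refine Submodule.subset_span ⟨1, s, v, ?_⟩
  simp [TensorProduct.smul_tmul']

theorem span_range_indι : Submodule.span U (Set.range (indι φ ρ)) = ⊤ := by
  rw [eq_top_iff]
  rintro m -
  obtain ⟨t, rfl⟩ := Submodule.mkQ_surjective _ m
  induction t with
  | zero => simp
  | add x y hx hy => rw [map_add]; exact Submodule.add_mem _ hx hy
  | tmul u v =>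
    have : u ⊗ₜ[k] v = u • ((1 : U) ⊗ₜ[k] v) := by simp [TensorProduct.smul_tmul']
    rw [this, map_smul]
    exact Submodule.smul_mem _ _ (Submodule.subset_span ⟨v, rfl⟩)

variable {M : Type u} [AddCommGroup M] [Module k M] [Module U M] [IsScalarTower k U M]

/-- The universal property of the induced module. -/
def indLift (θ : V →ₗ[k] M) (h : ∀ s v, θ (ρ s v) = φ s • θ v) : Ind φ ρ →ₗ[U] M :=
  Submodule.liftQ _ (TensorProduct.AlgebraTensorModule.lift
    (LinearMap.toSpanSingleton U (V →ₗ[k] M) θ)) <| by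
    rw [balanced, Submodule.span_le]
    rintro _ ⟨w, s, v, rfl⟩
    simp [mul_smul, h]

@[simp] theorem indLift_indι (θ : V →ₗ[k] M) (h : ∀ s v, θ (ρ s v) = φ s • θ v) (v : V) :
    indLift φ ρ θ h (indι φ ρ v) = θ v := by
  change TensorProduct.AlgebraTensorModule.lift
    (LinearMap.toSpanSingleton U (V →ₗ[k] M) θ) ((1 : U) ⊗ₜ[k] v) = _
  simp

end Induced

/-! ### The spanning half of the PBW theorem. -/

section Spanning

variable {k : Type u} [Field k] {g : Type*} [LieRing g] [LieAlgebra k g] {U : Type*} [Ring U]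
  [Algebra k U] (ι : g →ₗ[k] U) {M : Type*} [AddCommGroup M]
  [Module k M] [Module U M]

/-- The span of the vectors `d ^ i a ^ j v` with `i + j ≤ n` and `v ∈ V`. -/
def pbwFil (d a : g) (V : Submodule k M) (n : ℕ) : Submodule k M :=
  Submodule.span k {m | ∃ i j : ℕ, i + j ≤ n ∧ ∃ v ∈ V, m = ι d ^ i • ι a ^ j • v}

variable {ι} {d a : g} {V : Submodule k M}

theorem pbwFil_mono {n m : ℕ} (h : n ≤ m) : pbwFil ι d a V n ≤ pbwFil ι d a V m :=
  Submodule.span_mono fun _ ⟨i, j, hij, v, hv, e⟩ => ⟨i, j, hij.trans h, v, hv, e⟩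

theorem mem_pbwFil {n i j : ℕ} (h : i + j ≤ n) {v : M} (hv : v ∈ V) :
    ι d ^ i • ι a ^ j • v ∈ pbwFil ι d a V n := Submodule.subset_span ⟨i, j, h, v, hv, rfl⟩

variable [IsScalarTower k U M]

theorem smul_mem_of_span {s : Set M} {P : Submodule k M} {u : U} (h : ∀ m ∈ s, u • m ∈ P) {m : M}
    (hm : m ∈ Submodule.span k s) : u • m ∈ P := by
  induction hm using Submodule.span_induction with
  | mem m hm => exact h m hm
  | zero => rw [smul_zero]; exact P.zero_mem
  | add x y _ _ hx hy => rw [smul_add]; exact P.add_mem hx hy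
  | smul c x _ hx => rw [smul_comm]; exact P.smul_mem c hx

theorem smul_d_mem_pbwFil {n : ℕ} {m : M} (hm : m ∈ pbwFil ι d a V n) :
    ι d • m ∈ pbwFil ι d a V (n + 1) := by
  refine smul_mem_of_span ?_ hm
  rintro _ ⟨i, j, hij, v, hv, rfl⟩
  rw [← mul_smul, ← pow_succ']
  exact mem_pbwFil (by omega) hv

/-- Moving `x` past the first letter of a word leaves a commutator acting on a shorter word. That
commutator is an arbitrary element of `g`, even for `x ∈ g₀`, so the two claims have to be proved
together. -/
theorem pbwFil_stable (hι : ∀ x y, ι ⁅x, y⁆ = ι x * ι y - ι y * ι x) {g₀ : Submodule k g}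
    (hg : ∀ x : g, ∃ y ∈ g₀, ∃ α β : k, x = y + α • a + β • d)
    (hV : ∀ x ∈ g₀, ∀ v ∈ V, ι x • v ∈ V) (n : ℕ) :
    (∀ x ∈ g₀, ∀ m ∈ pbwFil ι d a V n, ι x • m ∈ pbwFil ι d a V n) ∧
    ∀ x, ∀ m ∈ pbwFil ι d a V n, ι x • m ∈ pbwFil ι d a V (n + 1) := by
  have hcomm : ∀ x y (m : M), ι x • ι y • m = ι y • ι x • m + ι ⁅x, y⁆ • m := by
    intro x y m
    rw [hι, sub_smul, mul_smul, mul_smul]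
    abel
  have hall : ∀ n, (∀ x ∈ g₀, ∀ m ∈ pbwFil ι d a V n, ι x • m ∈ pbwFil ι d a V n) →
      (∀ m ∈ pbwFil ι d a V n, ι a • m ∈ pbwFil ι d a V (n + 1)) →
      ∀ x, ∀ m ∈ pbwFil ι d a V n, ι x • m ∈ pbwFil ι d a V (n + 1) := by
    intro n h0 ha x m hm
    obtain ⟨y, hy, α, β, rfl⟩ := hg x
    rw [map_add, map_add, map_smul, map_smul, add_smul, add_smul, smul_assoc, smul_assoc]
    exact Submodule.add_mem _ (Submodule.add_mem _ (pbwFil_mono n.le_succ (h0 y hy m hm))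
      (Submodule.smul_mem _ _ (ha m hm))) (Submodule.smul_mem _ _ (smul_d_mem_pbwFil hm))
  induction n with
  | zero =>
    have h0 : ∀ x ∈ g₀, ∀ m ∈ pbwFil ι d a V 0, ι x • m ∈ pbwFil ι d a V 0 := by
      intro x hx m hm
      refine smul_mem_of_span ?_ hm
      rintro _ ⟨i, j, hij, v, hv, rfl⟩
      obtain ⟨rfl, rfl⟩ : i = 0 ∧ j = 0 := by omega
      simpa using mem_pbwFil (ι := ι) (d := d) (a := a) (i := 0) (j := 0) le_rfl (hV x hx v hv)
    refine ⟨h0, hall 0 h0 fun m hm => smul_mem_of_span ?_ hm⟩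
    rintro _ ⟨i, j, hij, v, hv, rfl⟩
    obtain ⟨rfl, rfl⟩ : i = 0 ∧ j = 0 := by omega
    simpa using mem_pbwFil (ι := ι) (d := d) (a := a) (n := 1) (i := 0) (j := 1) le_rfl hv
  | succ n ih =>
    obtain ⟨ih0, ih⟩ := ih
    have h0 : ∀ x ∈ g₀, ∀ m ∈ pbwFil ι d a V (n + 1), ι x • m ∈ pbwFil ι d a V (n + 1) := by
      intro x hx m hm
      refine smul_mem_of_span ?_ hm
      rintro _ ⟨i, j, hij, v, hv, rfl⟩
      rcases i with _ | i
      · rcases j with _ | j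
        · simpa using mem_pbwFil (ι := ι) (d := d) (a := a) (n := n + 1) (i := 0) (j := 0)
            (by omega) (hV x hx v hv)
        · have hm' : ι a ^ j • v ∈ pbwFil ι d a V n := by
            simpa using mem_pbwFil (ι := ι) (d := d) (a := a) (n := n) (i := 0) (j := j)
              (by omega) hv
          rw [pow_zero, one_smul, pow_succ', mul_smul, hcomm]
          exact Submodule.add_mem _ (ih _ _ (ih0 x hx _ hm')) (ih _ _ hm')
      · have hm' : ι d ^ i • ι a ^ j • v ∈ pbwFil ι d a V n := mem_pbwFil (by omega) hv
        rw [pow_succ', mul_smul, hcomm]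
        exact Submodule.add_mem _ (ih _ _ (ih0 x hx _ hm')) (ih _ _ hm')
    refine ⟨h0, hall _ h0 fun m hm => smul_mem_of_span ?_ hm⟩
    rintro _ ⟨i, j, hij, v, hv, rfl⟩
    rcases i with _ | i
    · rw [pow_zero, one_smul, ← mul_smul, ← pow_succ']
      simpa using mem_pbwFil (ι := ι) (d := d) (a := a) (n := n + 2) (i := 0) (j := j + 1)
        (by omega) hv
    · have hm' : ι d ^ i • ι a ^ j • v ∈ pbwFil ι d a V n := mem_pbwFil (by omega) hv
      rw [pow_succ', mul_smul, hcomm]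
      exact Submodule.add_mem _ (smul_d_mem_pbwFil (ih _ _ hm'))
        (pbwFil_mono (Nat.le_succ _) (ih _ _ hm'))

/-- The span of the vectors `d ^ i a ^ j v` with `i, j < p` and `v ∈ V`. -/
theorem span_pbw_stable (hι : ∀ x y, ι ⁅x, y⁆ = ι x * ι y - ι y * ι x) {g₀ : Submodule k g}
    (hg : ∀ x : g, ∃ y ∈ g₀, ∃ α β : k, x = y + α • a + β • d)
    (hV : ∀ x ∈ g₀, ∀ v ∈ V, ι x • v ∈ V) {p : ℕ} (hp : 0 < p) (hd : ι d ^ p = 0)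
    (ha : ∃ e ∈ g₀, ι a ^ p = ι e) (x : g) {m : M}
    (hm : m ∈ Submodule.span k {m | ∃ i j : Fin p, ∃ v ∈ V, m = ι d ^ (i : ℕ) • ι a ^ (j : ℕ) • v}) :
    ι x • m ∈
      Submodule.span k {m | ∃ i j : Fin p, ∃ v ∈ V, m = ι d ^ (i : ℕ) • ι a ^ (j : ℕ) • v} := by
  obtain ⟨e, he, hae⟩ := ha
  set P := Submodule.span k {m | ∃ i j : Fin p, ∃ v ∈ V, m = ι d ^ (i : ℕ) • ι a ^ (j : ℕ) • v}
  -- Large exponents reduce: `d^p` acts as zero, and `a^p` acts next to `V` as `e`, which maps `V`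
  -- to itself, so `a^j` may be replaced by `a^(j-p)` on another vector of `V`.
  have key : ∀ i j : ℕ, ∀ v ∈ V, ι d ^ i • ι a ^ j • v ∈ P := by
    intro i j
    induction j using Nat.strong_induction_on with
    | _ j ih =>
      intro v hv
      by_cases hi : i < p
      · by_cases hj : j < p
        · exact Submodule.subset_span ⟨⟨i, hi⟩, ⟨j, hj⟩, v, hv, rfl⟩
        · rw [← Nat.sub_add_cancel (not_lt.1 hj), pow_add, mul_smul, hae]
          exact ih _ (by omega) _ (hV e he v hv)
      · rw [← Nat.sub_add_cancel (not_lt.1 hi), pow_add, hd, mul_zero, zero_smul]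
        exact P.zero_mem
  refine smul_mem_of_span ?_ hm
  rintro _ ⟨i, j, v, hv, rfl⟩
  have h1 := (pbwFil_stable hι hg hV (i + j : ℕ)).2 x _
    (mem_pbwFil (ι := ι) (d := d) (a := a) (i := i) (j := j) le_rfl hv)
  refine (Submodule.span_le.2 ?_ : pbwFil ι d a V _ ≤ P) h1
  rintro _ ⟨i, j, -, v, hv, rfl⟩
  exact key i j v hv

end Spanning

/-! ### Densities, differential forms and the de Rham differential. -/

section Forms

variable {p : ℕ} {k : Type u} [Field k] [CharP k p]

/-- For `D = f ∂x + g ∂y` the commutator of `∂ᵢ` with `D` is `∂ᵢ(f) ∂x + ∂ᵢ(g) ∂y`, because the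
partial derivatives commute. -/
theorem partialD_witt (D : Witt p k) (i : Fin 2) (f : Trunc p k) :
    partialD p k i (D f) = D (partialD p k i f) +
      partialD p k i (D (tx p k)) * partialD p k 0 f +
      partialD p k i (D (ty p k)) * partialD p k 1 f := by
  rw [witt_apply D f, witt_apply D (partialD p k i f)]
  have h := partialD_comm f
  obtain rfl | rfl : i = 0 ∨ i = 1 := by fin_cases i <;> simp
  · simp only [map_add, Derivation.leibniz, smul_eq_mul, h]
    ring
  · simp only [map_add, Derivation.leibniz, smul_eq_mul, h]
    ring

variable (p k) in
/-- The divergence of a derivation. -/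
def diverg : Witt p k →ₗ[k] Trunc p k where
  toFun D := partialD p k 0 (D (tx p k)) + partialD p k 1 (D (ty p k))
  map_add' D E := by simp; ring
  map_smul' c D := by simp

theorem diverg_apply (D : Witt p k) :
    diverg p k D = partialD p k 0 (D (tx p k)) + partialD p k 1 (D (ty p k)) := rfl

/-- The products of first derivatives of the coefficients cancel by symmetry in `D` and `E`. This
cocycle identity is what makes the densities of every weight a Lie module. -/
theorem diverg_lie (D E : Witt p k) :
    diverg p k ⁅D, E⁆ = D (diverg p k E) - E (diverg p k D) := by
  simp only [diverg_apply, Derivation.commutator_apply, map_sub, map_add]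
  rw [partialD_witt D 0 (E _), partialD_witt D 1 (E _), partialD_witt E 0 (D _),
    partialD_witt E 1 (D _)]
  ring

/-- The action of derivations on densities of weight `c`: the derivation `D` acts by
`f ↦ D f + c (div D) f`. -/
def densHom (c : k) : Witt p k →ₗ⁅k⁆ Module.End k (Trunc p k) where
  toFun D := (D : Trunc p k →ₗ[k] Trunc p k) + c • LinearMap.mulLeft k (diverg p k D)
  map_add' D E := by
    ext f
    simp [add_mul]
    abel
  map_smul' r D := by
    ext f
    simp [smul_comm r c]
  map_lie' {D E} := by
    ext f
    have hs : ∀ a : Trunc p k, c • a = algebraMap k _ c * a := Algebra.smul_def c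
    simp only [diverg_lie, LieRing.of_associative_ring_bracket, LinearMap.add_apply,
      LinearMap.sub_apply, Module.End.mul_apply, LinearMap.smul_apply, LinearMap.mulLeft_apply,
      Derivation.coeFn_coe, Derivation.commutator_apply, map_add, Derivation.map_smul,
      Derivation.leibniz, smul_eq_mul]
    simp only [hs]
    ring

theorem densHom_apply (c : k) (D : Witt p k) (f : Trunc p k) :
    densHom c D f = D f + c • (diverg p k D * f) := rfl

variable (p k) in
/-- The exterior derivative from functions to `1`-forms `f dx + g dy`, written as pairs `(f, g)`. -/
def dZero : Trunc p k →ₗ[k] Trunc p k × Trunc p k :=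
  ((partialD p k 0 : Witt p k) : Trunc p k →ₗ[k] Trunc p k).prod
    ((partialD p k 1 : Witt p k) : Trunc p k →ₗ[k] Trunc p k)

theorem dZero_apply (f : Trunc p k) : dZero p k f = (partialD p k 0 f, partialD p k 1 f) := rfl

/-- The bilinear map sending `f` and `g` to the `1`-form `f dg`. -/
def formMul : Trunc p k →ₗ[k] Trunc p k →ₗ[k] Trunc p k × Trunc p k :=
  LinearMap.mk₂ k (fun f g => f • dZero p k g) (fun _ _ _ => add_smul _ _ _)
    (fun _ _ _ => smul_assoc _ _ _) (fun _ _ _ => by rw [map_add, smul_add])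
    (fun _ _ _ => by rw [map_smul, smul_comm])

theorem formMul_apply (f g : Trunc p k) : formMul f g = f • dZero p k g := rfl

theorem formMul_eq (f g : Trunc p k) :
    formMul f g = (f * partialD p k 0 g, f * partialD p k 1 g) := rfl

theorem form_eq (ω : Trunc p k × Trunc p k) :
    ω = formMul ω.1 (tx p k) + formMul ω.2 (ty p k) := by
  simp [formMul_eq]

/-- Linear maps on `1`-forms agree if they agree on the forms `f dg`. -/
theorem form_ext {V : Type*} [AddCommGroup V] [Module k V] {S T : Trunc p k × Trunc p k →ₗ[k] V}
    (h : ∀ f g, S (formMul f g) = T (formMul f g)) : S = T := by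
  refine LinearMap.ext fun ω => ?_
  rw [form_eq ω, map_add, map_add, h, h]

/-- The Lie derivative on `1`-forms. -/
def formAct (D : Witt p k) : Module.End k (Trunc p k × Trunc p k) where
  toFun ω := (D ω.1, D ω.2) + formMul ω.1 (D (tx p k)) + formMul ω.2 (D (ty p k))
  map_add' ω η := by
    ext <;> simp [formMul_eq] <;> ring
  map_smul' c ω := by
    ext <;> simp [formMul_eq]

theorem formAct_formMul (D : Witt p k) (f g : Trunc p k) :
    formAct D (formMul f g) = formMul (D f) g + formMul f (D g) := by
  ext
  · simp only [formAct, LinearMap.coe_mk, AddHom.coe_mk, formMul_eq, Derivation.leibniz,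
      smul_eq_mul, Prod.fst_add, partialD_witt D 0 g]
    ring
  · simp only [formAct, LinearMap.coe_mk, AddHom.coe_mk, formMul_eq, Derivation.leibniz,
      smul_eq_mul, Prod.snd_add, partialD_witt D 1 g]
    ring

/-- The representation of `W(2; (1,1))` on `1`-forms by Lie derivatives. -/
def formHom : Witt p k →ₗ⁅k⁆ Module.End k (Trunc p k × Trunc p k) where
  toFun := formAct
  map_add' D E := form_ext fun f g => by
    simp only [formAct_formMul, LinearMap.add_apply, Derivation.add_apply, map_add]
    abel
  map_smul' c D := form_ext fun f g => by
    simp only [formAct_formMul, LinearMap.smul_apply, Derivation.smul_apply, map_smul,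
      RingHom.id_apply, smul_add]
  map_lie' {D E} := form_ext fun f g => by
    simp only [formAct_formMul, LieRing.of_associative_ring_bracket, LinearMap.sub_apply,
      Module.End.mul_apply, Derivation.commutator_apply, map_add, map_sub]
    abel

theorem formHom_formMul (D : Witt p k) (f g : Trunc p k) :
    formHom D (formMul f g) = formMul (D f) g + formMul f (D g) := formAct_formMul D f g

/-- The wedge product of two `1`-forms. -/
def wedge : Trunc p k × Trunc p k →ₗ[k] Trunc p k × Trunc p k →ₗ[k] Trunc p k :=
  LinearMap.mk₂ k (fun a b => a.1 * b.2 - a.2 * b.1) (fun _ _ _ => by simp; ring)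
    (fun _ _ _ => by simp [smul_sub]) (fun _ _ _ => by simp; ring)
    (fun _ _ _ => by simp [smul_sub])

omit [CharP k p] in
theorem wedge_apply (a b : Trunc p k × Trunc p k) : wedge a b = a.1 * b.2 - a.2 * b.1 := rfl

theorem formHom_apply (D : Witt p k) (ω : Trunc p k × Trunc p k) :
    formHom D ω = (D ω.1, D ω.2) + formMul ω.1 (D (tx p k)) + formMul ω.2 (D (ty p k)) := rfl

/-- A 2-form `f dx ∧ dy` transforms as a density of weight one, since the Lie derivative of `dx ∧
dy` is the divergence. -/
theorem densHom_wedge (D : Witt p k) (a b : Trunc p k × Trunc p k) :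
    densHom 1 D (wedge a b) = wedge (formHom D a) b + wedge a (formHom D b) := by
  simp [densHom_apply, wedge_apply, formHom_apply, formMul_eq, diverg_apply, Derivation.leibniz]
  ring

theorem dZero_equivariant (D : Witt p k) (f : Trunc p k) :
    dZero p k (densHom 0 D f) = formHom D (dZero p k f) := by
  have h : ∀ g, dZero p k g = formMul 1 g := fun g => by simp [formMul_eq, dZero_apply]
  rw [h, h, formHom_formMul]
  simp [densHom_apply]

variable (p k) in
/-- The exterior derivative from `1`-forms to `2`-forms. -/
def dOne : Trunc p k × Trunc p k →ₗ[k] Trunc p k :=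
  ((partialD p k 0 : Witt p k) : Trunc p k →ₗ[k] Trunc p k) ∘ₗ LinearMap.snd k _ _ -
    ((partialD p k 1 : Witt p k) : Trunc p k →ₗ[k] Trunc p k) ∘ₗ LinearMap.fst k _ _

theorem dOne_apply (ω : Trunc p k × Trunc p k) :
    dOne p k ω = partialD p k 0 ω.2 - partialD p k 1 ω.1 := rfl

theorem dOne_formMul (f g : Trunc p k) :
    dOne p k (formMul f g) = wedge (dZero p k f) (dZero p k g) := by
  simp [dOne_apply, formMul_eq, wedge_apply, dZero_apply, Derivation.leibniz, partialD_comm g]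
  ring

theorem dOne_equivariant (D : Witt p k) (ω : Trunc p k × Trunc p k) :
    dOne p k (formHom D ω) = densHom 1 D (dOne p k ω) := by
  have h0 : ∀ f, formHom D (dZero p k f) = dZero p k (D f) := fun f => by
    rw [← dZero_equivariant]; simp [densHom_apply]
  have : dOne p k ∘ₗ formHom D = densHom 1 D ∘ₗ dOne p k := form_ext fun f g => by
    simp only [LinearMap.comp_apply, formHom_formMul, map_add, dOne_formMul, densHom_wedge, h0]
  exact LinearMap.congr_fun this ω

variable [Fact p.Prime]

omit [CharP k p] [Fact p.Prime] in
theorem witt_pow_apply (D : Witt p k) (n : ℕ) (f : Trunc p k) :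
    ((D : Trunc p k →ₗ[k] Trunc p k) ^ n) f = (⇑D)^[n] f := by
  rw [Module.End.coe_pow]
  rfl

theorem formHom_pow_char {D E : Witt p k} (h : ∀ f, E f = (⇑D)^[p] f) :
    formHom D ^ p = formHom E := form_ext fun f g => by
  rw [leibniz_pow_char p formMul (S := (D : Trunc p k →ₗ[k] Trunc p k))
    (T := (D : Trunc p k →ₗ[k] Trunc p k)) (fun a b => formHom_formMul D a b),
    witt_pow_apply, witt_pow_apply, ← h, ← h, formHom_formMul]

/-- Every density of weight one is a product `(f dx) ∧ dy`, so compatibility with the `p`-map is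
inherited from 1-forms by the Leibniz rule for `p`-th powers. -/
theorem densHom_one_pow_char {D E : Witt p k} (h : ∀ f, E f = (⇑D)^[p] f) :
    densHom (1 : k) D ^ p = densHom 1 E := by
  refine LinearMap.ext fun f => ?_
  have hf : f = wedge (f, 0) (0, 1) := by simp [wedge_apply]
  rw [hf, leibniz_pow_char p wedge (densHom_wedge D), formHom_pow_char h, ← densHom_wedge]

/-- Multiplication pairs weights `n` and `1` into weight `n + 1` compatibly with the action, so
restrictedness spreads from weight one by induction. Natural numbers reach every weight in the prime
field. -/
theorem densHom_natCast_pow_char {D E : Witt p k} (h : ∀ f, E f = (⇑D)^[p] f) (n : ℕ) :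
    densHom (n : k) D ^ p = densHom (n : k) E := by
  induction n with
  | zero =>
    refine LinearMap.ext fun f => ?_
    have h0 : ∀ D : Witt p k, densHom ((0 : ℕ) : k) D = (D : Trunc p k →ₗ[k] Trunc p k) := by
      intro D
      ext f
      simp [densHom_apply]
    rw [h0, h0, witt_pow_apply, ← h, Derivation.coeFn_coe]
  | succ n ih =>
    have hmul : ∀ (D : Witt p k) (a b : Trunc p k), densHom ((n + 1 : ℕ) : k) D
        (LinearMap.mul k (Trunc p k) a b) = LinearMap.mul k (Trunc p k) (densHom (n : k) D a) b +
          LinearMap.mul k (Trunc p k) a (densHom (1 : k) D b) := by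
      intro D a b
      simp [densHom_apply, Derivation.leibniz, mul_add, add_mul, Algebra.smul_def]
      ring
    refine LinearMap.ext fun f => ?_
    have hf : f = LinearMap.mul k (Trunc p k) f 1 := by simp
    rw [hf, leibniz_pow_char p _ (hmul D), ih, densHom_one_pow_char h, ← hmul]

theorem densHom_pow_char (c : ZMod p) {D E : Witt p k} (h : ∀ f, E f = (⇑D)^[p] f) :
    densHom (ZMod.castHom dvd_rfl k c) D ^ p = densHom (ZMod.castHom dvd_rfl k c) E := by
  have : ZMod.castHom dvd_rfl k c = ((c.val : ℕ) : k) := by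
    rw [← map_natCast (ZMod.castHom dvd_rfl k), ZMod.natCast_zmod_val]
  rw [this]
  exact densHom_natCast_pow_char h _

variable (p k)

/-- The representation of `u(Ĥ)` on densities of weight `c`. -/
def densRep (c : ZMod p) : UHat p k →ₐ[k] Module.End k (Trunc p k) :=
  resLift p (Hhat p k) ((densHom (ZMod.castHom dvd_rfl k c)).comp (Hhat p k).incl) fun _ _ h =>
    densHom_pow_char c h

/-- The representation of `u(Ĥ)` on `1`-forms. -/
def formRep : UHat p k →ₐ[k] Module.End k (Trunc p k × Trunc p k) :=
  resLift p (Hhat p k) (formHom.comp (Hhat p k).incl) fun _ _ h => formHom_pow_char h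

/-- The `u(Ĥ)`-module of densities of weight `c`. -/
abbrev Dens (c : ZMod p) : Type u := RepMod (densRep p k c)

/-- The `u(Ĥ)`-module of `1`-forms. -/
abbrev Forms : Type u := RepMod (formRep p k)

variable {p k}

theorem densRep_resι (c : ZMod p) (D : Hhat p k) :
    densRep p k c (resι p (Hhat p k) D) = densHom (ZMod.castHom dvd_rfl k c) (D : Witt p k) := by
  exact resLift_resι _ _ D

theorem formRep_resι (D : Hhat p k) :
    formRep p k (resι p (Hhat p k) D) = formHom (D : Witt p k) := by
  exact resLift_resι _ _ D

variable (p k)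

/-- The exterior derivative from `1`-forms to `2`-forms as a map of `u(Ĥ)`-modules. -/
def dOneHom : Forms p k →ₗ[UHat p k] Dens p k 1 :=
  equivariantMap ((toRepMod _).toLinearMap ∘ₗ dOne p k ∘ₗ (toRepMod _).symm.toLinearMap)
    fun D m => by
      simp only [LinearMap.comp_apply, LinearEquiv.coe_coe, toRepMod_symm_smul, densRep_resι,
        map_one, dOne_equivariant, smul_toRepMod, formRep_resι]

end Forms

/-! ### Projection to weight spaces. -/

section Weights

variable {p : ℕ} [Fact p.Prime] {k : Type u} [Field k] [CharP k p] {V : Type*} [AddCommGroup V]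
  [Module k V] {ι : Type*} [Fintype ι]

/-- A subspace stable under a diagonalizable operator with eigenvalues in the prime field contains
the weight components of its elements. -/
theorem weight_component_mem (b : Module.Basis ι k V) {T : Module.End k V} {wt : ι → ZMod p}
    (hT : ∀ i, T (b i) = (ZMod.castHom dvd_rfl k (wt i)) • b i) {P : Submodule k V}
    (hP : ∀ v ∈ P, T v ∈ P) {v : V} (hv : v ∈ P) (μ : ZMod p) :
    ∑ i with wt i = μ, b.repr v i • b i ∈ P := by
  set κ := ZMod.castHom (dvd_refl p) k
  have hpow : ∀ (n : ℕ) (i : ι), ((T - κ μ • (1 : Module.End k V)) ^ n) (b i) =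
      κ ((wt i - μ) ^ n) • b i := by
    intro n i
    induction n with
    | zero => simp
    | succ n ih =>
      rw [pow_succ', Module.End.mul_apply, ih, map_smul, LinearMap.sub_apply, hT,
        LinearMap.smul_apply, Module.End.one_apply, ← sub_smul, smul_smul, pow_succ, map_mul,
        map_sub]
  have hmem : ∀ n : ℕ, ∀ w ∈ P, ((T - κ μ • (1 : Module.End k V)) ^ n) w ∈ P := by
    intro n
    induction n with
    | zero => intro w hw; simpa using hw
    | succ n ih =>
      intro w hw
      rw [pow_succ, Module.End.mul_apply]
      refine ih _ (P.sub_mem (hP w hw) (P.smul_mem _ hw))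
  -- By Fermat's little theorem `1 - (T - μ)^(p-1)` is the projection to the eigenspace of `μ`, and
  -- it is a polynomial in `T`.
  have key : ∑ i with wt i = μ, b.repr v i • b i =
      v - ((T - κ μ • (1 : Module.End k V)) ^ (p - 1)) v := by
    conv_rhs => rw [← b.sum_repr v, map_sum, ← Finset.sum_sub_distrib]
    rw [Finset.sum_filter]
    refine Finset.sum_congr rfl fun i _ => ?_
    rw [map_smul, hpow, ← smul_sub]
    split_ifs with h
    · rw [h, sub_self, zero_pow (by have := (Fact.out : p.Prime).two_le; omega), map_zero,
        zero_smul, sub_zero]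
    · rw [ZMod.pow_card_sub_one_eq_one (sub_ne_zero.2 h), map_one, one_smul, sub_self, smul_zero]
  rw [key]
  exact P.sub_mem hv (hmem _ _ hv)

/-- The version of `weight_component_mem` for two operators. -/
theorem weight_component_mem₂ (b : Module.Basis ι k V) {S T : Module.End k V} {wt wt' : ι → ZMod p}
    (hS : ∀ i, S (b i) = (ZMod.castHom dvd_rfl k (wt i)) • b i)
    (hT : ∀ i, T (b i) = (ZMod.castHom dvd_rfl k (wt' i)) • b i) {P : Submodule k V}
    (hSP : ∀ v ∈ P, S v ∈ P) (hTP : ∀ v ∈ P, T v ∈ P) {v : V} (hv : v ∈ P) (μ ν : ZMod p) :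
    ∑ i with wt i = μ ∧ wt' i = ν, b.repr v i • b i ∈ P := by
  classical
  have h := weight_component_mem b hT hTP (weight_component_mem b hS hSP hv μ) ν
  convert h using 1
  rw [← Finset.filter_filter, Finset.sum_filter, Finset.sum_filter, Finset.sum_filter]
  refine Finset.sum_congr rfl fun i _ => ?_
  rw [Finset.sum_filter, map_sum, Finsupp.finsetSum_apply, Finset.sum_eq_single i]
  · split_ifs <;> simp
  · intro j _ hj
    split_ifs
    · simp [hj]
    · simp
  · simp

end Weights

/-! ### Coefficients of truncated polynomials. -/

section Coefficients

variable {p : ℕ} {k : Type u} [Field k]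

/-- The coefficient of `x ^ i y ^ j`. -/
def coef (i j : ℕ) : Trunc p k →ₗ[k] k :=
  if h : i < p ∧ j < p then (monoBasis p k).coord (⟨i, h.1⟩, ⟨j, h.2⟩) else 0

theorem coef_eq_repr (ij : Fin p × Fin p) (f : Trunc p k) :
    coef ij.1 ij.2 f = (monoBasis p k).repr f ij := by
  rw [coef, dif_pos ⟨ij.1.2, ij.2.2⟩]
  rfl

theorem coef_monomial {i j a b : ℕ} (hi : i < p) (hj : j < p) (ha : a < p) (hb : b < p) :
    coef i j (tx p k ^ a * ty p k ^ b) = if a = i ∧ b = j then 1 else 0 := by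
  have h : tx p k ^ a * ty p k ^ b = monoBasis p k (⟨a, ha⟩, ⟨b, hb⟩) := by simp [mono]
  rw [coef, dif_pos ⟨hi, hj⟩, h, Module.Basis.coord_apply, Module.Basis.repr_self_apply]
  simp

theorem mem_of_coef {P : Submodule k (Trunc p k)} {f : Trunc p k}
    (h : ∀ i < p, ∀ j < p, coef i j f ≠ 0 → tx p k ^ i * ty p k ^ j ∈ P) : f ∈ P := by
  rw [← (monoBasis p k).sum_repr f]
  refine P.sum_mem fun ij _ => ?_
  rw [← coef_eq_repr, monoBasis_apply]
  by_cases h0 : coef (ij.1 : ℕ) (ij.2 : ℕ) f = 0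
  · rw [h0, zero_smul]; exact P.zero_mem
  · exact P.smul_mem _ (h _ ij.1.2 _ ij.2.2 h0)

theorem exists_coef_ne_zero {f : Trunc p k} (hf : f ≠ 0) :
    ∃ i < p, ∃ j < p, coef i j f ≠ 0 := by
  by_contra! h
  refine hf ((Submodule.mem_bot k).1 (mem_of_coef fun i hi j hj h0 => absurd (h i hi j hj) h0))

variable [CharP k p]

theorem natCast_ne_zero_of_lt {n : ℕ} (h0 : 0 < n) (hn : n < p) : (n : k) ≠ 0 := by
  rw [Ne, CharP.cast_eq_zero_iff k p]
  exact Nat.not_dvd_of_pos_of_lt h0 hn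

theorem coef_partialD_zero {j : ℕ} (f : Trunc p k) : coef (p - 1) j (partialD p k 0 f) = 0 := by
  by_cases hj : p - 1 < p ∧ j < p
  · have : coef (p - 1) j ∘ₗ ((partialD p k 0 : Witt p k) : Trunc p k →ₗ[k] Trunc p k) = 0 := by
      refine linearMap_ext_monomials fun a ha b hb => ?_
      rw [LinearMap.comp_apply, Derivation.coeFn_coe, partialD_zero_monomial, map_smul,
        coef_monomial hj.1 hj.2 (by omega) hb, LinearMap.zero_apply]
      rcases Nat.eq_zero_or_pos a with rfl | h0
      · simp
      · rw [if_neg (by omega), smul_zero]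
    exact LinearMap.congr_fun this f
  · rw [coef, dif_neg hj, LinearMap.zero_apply]

/-- At `j = p - 1` both sides vanish: the factor `p` is zero in `k`, and `coef i p` is the default
zero map. -/
theorem coef_partialD_one {i j : ℕ} (hi : i < p) (hj : j < p) (f : Trunc p k) :
    coef i j (partialD p k 1 f) = ((j + 1 : ℕ) : k) * coef i (j + 1) f := by
  have : coef i j ∘ₗ ((partialD p k 1 : Witt p k) : Trunc p k →ₗ[k] Trunc p k) =
      ((j + 1 : ℕ) : k) • coef i (j + 1) := by
    refine linearMap_ext_monomials fun a ha b hb => ?_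
    rw [LinearMap.comp_apply, Derivation.coeFn_coe, partialD_one_monomial, map_smul,
      coef_monomial hi hj ha (by omega), LinearMap.smul_apply]
    by_cases hj' : j + 1 < p
    · rw [coef_monomial hi hj' ha hb]
      rcases Nat.eq_zero_or_pos b with rfl | h0
      · simp
      · by_cases h : b = j + 1
        · simp [h]
        · rw [if_neg (by omega), if_neg (by omega), smul_zero, smul_zero]
    · rw [show j + 1 = p by omega, CharP.cast_eq_zero k p, zero_smul]
      rcases Nat.eq_zero_or_pos b with rfl | h0
      · simp
      · rw [if_neg (by omega), smul_zero]
  exact LinearMap.congr_fun this f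

end Coefficients

/-! ### Explicit elements of `Ĥ` and their action on monomials. -/

section Elements

variable (p : ℕ) (k : Type u) [Field k] [CharP k p]

/-- The derivation `j y ^ (j - 1) ∂x - x ^ (p - 1) / (p - 1)! y ^ j ∂y`. -/
def hamA (j : ℕ) : Witt p k :=
  ((j : k) • ty p k ^ (j - 1)) • partialD p k 0 -
    (((p - 1).factorial : k)⁻¹ • (tx p k ^ (p - 1) * ty p k ^ j)) • partialD p k 1

/-- The derivation `i x ^ (i - 1) y ^ j ∂y - j x ^ i y ^ (j - 1) ∂x`. -/
def hamB (i j : ℕ) : Witt p k :=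
  ((i : k) • (tx p k ^ (i - 1) * ty p k ^ j)) • partialD p k 1 -
    ((j : k) • (tx p k ^ i * ty p k ^ (j - 1))) • partialD p k 0

variable {p k}

omit [CharP k p] in
theorem dpow_natCast (f : Trunc p k) (n : ℕ) : dpow f n = (n.factorial : k)⁻¹ • f ^ n := by
  simp [dpow]

/-- This clears the divided powers. The convention for the exponent `-1` becomes a coefficient `n`
that is zero at `n = 0`, so truncated subtraction does no harm. -/
theorem factorial_smul_dpow_pred [Fact p.Prime] (f : Trunc p k) {n : ℕ} (hn : n < p) :
    (n.factorial : k) • dpow f (n - 1 : ℤ) = (n : k) • f ^ (n - 1) := by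
  rcases n with _ | n
  · simp [dpow]
  · have h0 : (n.factorial : k) ≠ 0 := by
      rw [Ne, CharP.cast_eq_zero_iff k p, (Fact.out : p.Prime).dvd_factorial]
      omega
    rw [show ((n + 1 : ℕ) : ℤ) - 1 = (n : ℕ) by push_cast; ring, dpow_natCast, smul_smul,
      Nat.factorial_succ, Nat.cast_mul, mul_assoc, mul_inv_cancel₀ h0, mul_one, Nat.add_sub_cancel]

variable [Fact p.Prime]

theorem factorial_ne_zero_of_lt {n : ℕ} (hn : n < p) : (n.factorial : k) ≠ 0 := by
  rw [Ne, CharP.cast_eq_zero_iff k p, (Fact.out : p.Prime).dvd_factorial]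
  omega

theorem factorial_smul_dpow (f : Trunc p k) {n : ℕ} (hn : n < p) :
    (n.factorial : k) • dpow f (n : ℤ) = f ^ n := by
  rw [dpow_natCast, smul_smul, mul_inv_cancel₀ (factorial_ne_zero_of_lt hn), one_smul]

theorem hamA_mem {j : ℕ} (hj : j < p) : hamA p k j ∈ Hhat p k := by
  have hp := (Fact.out : p.Prime).pos
  have h : hamA p k j = (j.factorial : k) • (dpow (ty p k) ((j : ℤ) - 1) • partialD p k 0
        - (dpow (tx p k) ((p : ℤ) - 1) * dpow (ty p k) j) • partialD p k 1) := by
    rw [smul_sub, ← smul_assoc, ← smul_assoc, factorial_smul_dpow_pred _ hj, ← mul_smul_comm,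
      factorial_smul_dpow _ hj, show (p : ℤ) - 1 = ((p - 1 : ℕ) : ℤ) by omega, dpow_natCast,
      smul_mul_assoc]
    rfl
  rw [h]
  refine (Hhat p k).smul_mem _ (LieSubalgebra.subset_lieSpan (Or.inl (Or.inl ?_)))
  exact ⟨j, by omega, by omega, rfl⟩

theorem hamB_mem {i j : ℕ} (hi0 : 1 ≤ i) (hi : i < p) (hj : j < p) : hamB p k i j ∈ Hhat p k := by
  have h : hamB p k i j = ((i.factorial : k) * (j.factorial : k)) •
      ((dpow (tx p k) ((i : ℤ) - 1) * dpow (ty p k) j) • partialD p k 1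
        - (dpow (tx p k) i * dpow (ty p k) ((j : ℤ) - 1)) • partialD p k 0) := by
    rw [smul_sub, ← smul_assoc, ← smul_assoc, ← smul_mul_smul_comm, ← smul_mul_smul_comm,
      factorial_smul_dpow_pred _ hj, factorial_smul_dpow_pred _ hi,
      factorial_smul_dpow _ hj, factorial_smul_dpow _ hi, smul_mul_assoc, mul_smul_comm]
    rfl
  rw [h]
  refine (Hhat p k).smul_mem _ (LieSubalgebra.subset_lieSpan (Or.inl (Or.inr ?_)))
  exact ⟨i, j, by omega, by omega, by omega, by omega, rfl⟩

variable (p k) in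
theorem partialD_one_mem : partialD p k 1 ∈ Hhat p k := by
  have hp := (Fact.out : p.Prime).two_le
  have := hamB_mem (p := p) (k := k) (i := 1) (j := 0) le_rfl (by omega) (by omega)
  simpa [hamB] using this

/-- The added generator is the sum of the two Euler fields and `hamB p k 1 1` is their difference `y
∂y - x ∂x`; division by `2` separates them. -/
theorem euler_mem (hp : 5 ≤ p) :
    tx p k • partialD p k 0 ∈ Hhat p k ∧ ty p k • partialD p k 1 ∈ Hhat p k := by
  have h1 : tx p k • partialD p k 0 + ty p k • partialD p k 1 ∈ Hhat p k :=
    LieSubalgebra.subset_lieSpan (Or.inr rfl)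
  have h2 : ty p k • partialD p k 1 - tx p k • partialD p k 0 ∈ Hhat p k := by
    simpa [hamB] using hamB_mem (p := p) (k := k) (i := 1) (j := 1) le_rfl (by omega) (by omega)
  have h20 : (2 : k) ≠ 0 := by
    exact_mod_cast natCast_ne_zero_of_lt (p := p) (k := k) (n := 2) (by omega) (by omega)
  constructor
  · have := (Hhat p k).smul_mem (2 : k)⁻¹ ((Hhat p k).sub_mem h1 h2)
    convert this using 1
    rw [eq_inv_smul_iff₀ h20, two_smul]
    abel
  · have := (Hhat p k).smul_mem (2 : k)⁻¹ ((Hhat p k).add_mem h1 h2)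
    convert this using 1
    rw [eq_inv_smul_iff₀ h20, two_smul]
    abel

omit [Fact p.Prime] in
theorem hamA_tx (j : ℕ) : hamA p k j (tx p k) = (j : k) • ty p k ^ (j - 1) := by
  simp [hamA]

omit [Fact p.Prime] in
theorem hamA_ty (j : ℕ) : hamA p k j (ty p k) =
    -(((p - 1).factorial : k)⁻¹ • (tx p k ^ (p - 1) * ty p k ^ j)) := by
  simp [hamA]

omit [Fact p.Prime] in
theorem diverg_hamA (j : ℕ) : diverg p k (hamA p k j) =
    -((((p - 1).factorial : k)⁻¹ * j) • (tx p k ^ (p - 1) * ty p k ^ (j - 1))) := by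
  rw [diverg_apply, hamA_tx, hamA_ty, map_neg, Derivation.map_smul, Derivation.map_smul,
    partialD_one_monomial, Derivation.leibniz_pow, partialD_zero_ty, smul_smul]
  simp

/-- The second term of `hamA p k j` and its divergence both carry `x^(p-1)`, which kills a monomial
divisible by `x`. What remains is `j y^(j-1) ∂x`, whatever the weight. -/
theorem densHom_hamA_pos (c : k) {j a b : ℕ} (hj : 0 < j) (ha : 0 < a) :
    densHom c (hamA p k j) (tx p k ^ a * ty p k ^ b) =
      ((j : k) * a) • (tx p k ^ (a - 1) * ty p k ^ (b + j - 1)) := by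
  have hx : tx p k ^ (p - 1) * tx p k ^ a = 0 := by
    rw [← pow_add]
    exact tx_pow_eq_zero (by have := (Fact.out : p.Prime).pos; omega)
  have h1 : (tx p k ^ (p - 1) * ty p k ^ j) * (tx p k ^ a * ty p k ^ (b - 1)) = 0 := by
    linear_combination (ty p k ^ j * ty p k ^ (b - 1)) * hx
  have h2 : (tx p k ^ (p - 1) * ty p k ^ (j - 1)) * (tx p k ^ a * ty p k ^ b) = 0 := by
    linear_combination (ty p k ^ (j - 1) * ty p k ^ b) * hx
  rw [densHom_apply, witt_apply, hamA_tx, hamA_ty, diverg_hamA, partialD_zero_monomial,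
    partialD_one_monomial, neg_mul, neg_mul, smul_mul_smul_comm, smul_mul_smul_comm,
    smul_mul_assoc, h1, h2, show b + j - 1 = (j - 1) + b by omega, pow_add]
  simp [mul_left_comm]

omit [Fact p.Prime] in
-- On powers of `y` only the second term and the divergence survive, and the exponent of `x` jumps
-- from `0` to `p - 1`. For `j = p - 1` the factor `b + c j` equals `b - c` in `k`: its zeros at `b
-- = c = 0` and `b = c = 1` are the source of the two exceptional modules.
theorem densHom_hamA_zero (c : k) {j b : ℕ} (hj : 0 < j) :
    densHom c (hamA p k j) (tx p k ^ 0 * ty p k ^ b) =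
      -((((p - 1).factorial : k)⁻¹ * (b + c * j)) •
        (tx p k ^ (p - 1) * ty p k ^ (b + j - 1))) := by
  have h1 : (b : k) • ((tx p k ^ (p - 1) * ty p k ^ j) * (tx p k ^ 0 * ty p k ^ (b - 1))) =
      (b : k) • (tx p k ^ (p - 1) * ty p k ^ (b + j - 1)) := by
    rcases b with _ | b
    · simp
    · rw [show b + 1 + j - 1 = j + b by omega, pow_add]
      simp [mul_assoc]
  have h2 : (tx p k ^ (p - 1) * ty p k ^ (j - 1)) * (tx p k ^ 0 * ty p k ^ b) =
      tx p k ^ (p - 1) * ty p k ^ (b + j - 1) := by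
    rw [show b + j - 1 = (j - 1) + b by omega, pow_add]
    ring
  rw [densHom_apply, witt_apply, hamA_tx, hamA_ty, diverg_hamA, partialD_zero_monomial,
    partialD_one_monomial, neg_mul, neg_mul, smul_mul_assoc _ _ ((b : k) • _),
    mul_smul_comm (b : k), h1, smul_mul_assoc (_ * _), h2]
  simp only [Nat.cast_zero, zero_smul, mul_zero, zero_add, smul_neg, smul_smul, ← neg_add,
    ← add_smul]
  congr 2
  ring

end Elements

/-- A property of pairs of exponents that can be lowered. -/
theorem lowering_induction {p : ℕ} {P : ℕ → ℕ → Prop}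
    (hx : ∀ i j, 0 < i → i < p → j < p → P i j → P (i - 1) j)
    (hy : ∀ i j, 0 < j → i < p → j < p → P i j → P i (j - 1)) {a b i j : ℕ} (ha : a < p) (hb : b < p)
    (hi : i ≤ a) (hj : j ≤ b) (h : P a b) : P i j := by
  have h1 : P i b := by
    induction hi using Nat.decreasingInduction with
    | self => exact h
    | of_succ n hn ih => exact hx (n + 1) b (by omega) (by omega) hb ih
  induction hj using Nat.decreasingInduction with
  | self => exact h1
  | of_succ n hn ih => exact hy i (n + 1) (by omega) (by omega) (by omega) ih

/-! ### Submodules of the densities. -/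

section DensSubmodules

variable {p : ℕ} [Fact p.Prime] {k : Type u} [Field k] [CharP k p]

/-- A subspace of the truncated polynomial ring stable under `Ĥ` acting on densities of
weight `c`. -/
def DensStable (c : ZMod p) (P : Submodule k (Trunc p k)) : Prop :=
  ∀ D ∈ Hhat p k, ∀ f ∈ P, densHom (ZMod.castHom dvd_rfl k c) D f ∈ P

namespace DensStable

variable {c : ZMod p} {P : Submodule k (Trunc p k)} (hP : DensStable c P)
include hP

theorem lower_y {i j : ℕ} (h0 : 0 < j) (hj : j < p) (h : tx p k ^ i * ty p k ^ j ∈ P) :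
    tx p k ^ i * ty p k ^ (j - 1) ∈ P := by
  have h1 := hP _ (partialD_one_mem p k) _ h
  rw [densHom_apply, partialD_one_monomial, diverg_apply] at h1
  simp only [partialD_one_tx, partialD_one_ty, map_zero, Derivation.map_one_eq_zero, add_zero, zero_mul,
    smul_zero] at h1
  exact (P.smul_mem_iff (natCast_ne_zero_of_lt h0 hj)).1 h1

theorem lower_x {i j : ℕ} (h0 : 0 < i) (hi : i < p) (h : tx p k ^ i * ty p k ^ j ∈ P) :
    tx p k ^ (i - 1) * ty p k ^ j ∈ P := by
  have h1 := hP _ (hamA_mem (Fact.out : p.Prime).one_lt) _ h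
  rw [densHom_hamA_pos _ one_pos h0, Nat.cast_one, one_mul] at h1
  exact (P.smul_mem_iff (natCast_ne_zero_of_lt h0 hi)).1 h1

theorem lower {a b i j : ℕ} (ha : a < p) (hb : b < p) (hi : i ≤ a) (hj : j ≤ b)
    (h : tx p k ^ a * ty p k ^ b ∈ P) : tx p k ^ i * ty p k ^ j ∈ P :=
  lowering_induction (p := p) (P := fun i j => tx p k ^ i * ty p k ^ j ∈ P)
    (fun _ _ h0 hi _ h => hP.lower_x h0 hi h) (fun _ _ h0 _ hj h => hP.lower_y h0 hj h) ha hb hi hj h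

theorem eq_top_of_top_mem (h : tx p k ^ (p - 1) * ty p k ^ (p - 1) ∈ P) : P = ⊤ := by
  have hp := (Fact.out : p.Prime).pos
  exact eq_top_of_monomials fun i hi j hj =>
    hP.lower (by omega) (by omega) (by omega) (by omega) h

theorem raise_one (hc : c ≠ 0) (h : tx p k ^ 0 * ty p k ^ 0 ∈ P) :
    tx p k ^ (p - 1) * ty p k ^ (p - 2) ∈ P := by
  have hp := (Fact.out : p.Prime).two_le
  have h1 := hP _ (hamA_mem (j := p - 1) (by omega)) _ h
  rw [densHom_hamA_zero _ (by omega), P.neg_mem_iff, P.smul_mem_iff] at h1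
  · simpa [Nat.sub_sub] using h1
  · have hc' : ZMod.castHom (dvd_refl p) k c ≠ 0 := (map_ne_zero _).2 hc
    rw [Nat.cast_zero, zero_add]
    exact mul_ne_zero (inv_ne_zero (factorial_ne_zero_of_lt (by omega)))
      (mul_ne_zero hc' (natCast_ne_zero_of_lt (by omega) (by omega)))

theorem eq_top_of_y_mem (hc : c ≠ 1) (h : tx p k ^ 0 * ty p k ^ 1 ∈ P) : P = ⊤ := by
  have hp := (Fact.out : p.Prime).two_le
  have h1 := hP _ (hamA_mem (j := p - 1) (by omega)) _ h
  rw [densHom_hamA_zero _ (by omega), P.neg_mem_iff, P.smul_mem_iff] at h1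
  · rw [Nat.add_sub_cancel_left] at h1
    exact hP.eq_top_of_top_mem h1
  · refine mul_ne_zero (inv_ne_zero (factorial_ne_zero_of_lt (by omega))) ?_
    rw [Nat.cast_sub (by omega), CharP.cast_eq_zero k p, Nat.cast_one, zero_sub, mul_neg, mul_one,
      ← sub_eq_add_neg, sub_ne_zero, ← map_one (ZMod.castHom (dvd_refl p) k)]
    exact fun h => hc ((ZMod.castHom (dvd_refl p) k).injective h).symm

/-- The monomial `x^i y^j` has weight `(i + c, j + c)` under `x ∂x` and `y ∂y`. As the exponents are
below `p`, distinct monomials have distinct weights, so each weight component of `f` is a single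
term. -/
theorem monomial_mem (hp : 5 ≤ p) {f : Trunc p k} (hf : f ∈ P) {i j : ℕ} (hi : i < p) (hj : j < p)
    (h : coef i j f ≠ 0) : tx p k ^ i * ty p k ^ j ∈ P := by
  obtain ⟨hX, hY⟩ := euler_mem (p := p) (k := k) hp
  have hmem := weight_component_mem₂ (monoBasis p k)
    (wt := fun ij => ((ij.1 : ℕ) : ZMod p) + c) (wt' := fun ij => ((ij.2 : ℕ) : ZMod p) + c)
    (S := densHom (ZMod.castHom dvd_rfl k c) (tx p k • partialD p k 0))
    (T := densHom (ZMod.castHom dvd_rfl k c) (ty p k • partialD p k 1)) ?_ ?_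
    (hP _ hX) (hP _ hY) hf (i + c) (j + c)
  · rw [Finset.sum_eq_single (⟨i, hi⟩, ⟨j, hj⟩), ← coef_eq_repr, monoBasis_apply,
      P.smul_mem_iff h] at hmem
    · exact hmem
    · rintro ⟨a, b⟩ hab hne
      simp only [Finset.mem_filter, Finset.mem_univ, true_and, add_left_inj,
        ZMod.natCast_eq_natCast_iff'] at hab
      rw [Nat.mod_eq_of_lt a.2, Nat.mod_eq_of_lt b.2, Nat.mod_eq_of_lt hi, Nat.mod_eq_of_lt hj]
        at hab
      exact absurd (Prod.ext (Fin.ext hab.1) (Fin.ext hab.2)) hne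
    · intro h
      simp at h
  · rintro ⟨⟨a, ha⟩, b⟩
    rw [monoBasis_apply, mono, densHom_apply, Derivation.smul_apply, partialD_zero_monomial,
      diverg_apply]
    rcases a with _ | a <;>
      simp [Algebra.smul_def, pow_succ']
    ring
  · rintro ⟨a, ⟨b, hb⟩⟩
    rw [monoBasis_apply, mono, densHom_apply, Derivation.smul_apply, partialD_one_monomial,
      diverg_apply]
    rcases b with _ | b <;>
      simp [Algebra.smul_def, pow_succ']
    ring

theorem one_mem (hp : 5 ≤ p) (hne : P ≠ ⊥) : tx p k ^ 0 * ty p k ^ 0 ∈ P := by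
  obtain ⟨f, hf, h0⟩ := P.exists_mem_ne_zero_of_ne_bot hne
  obtain ⟨i, hi, j, hj, hij⟩ := exists_coef_ne_zero h0
  exact hP.lower hi hj (Nat.zero_le _) (Nat.zero_le _) (hP.monomial_mem hp hf hi hj hij)

/-- The passage from `1` to `x^(p-1) y^(p-2)`, then down to `y`, then up to the top monomial is open
exactly because neither factor `-c` nor `1 - c` vanishes. -/
theorem eq_bot_or_eq_top (hp : 5 ≤ p) (h0 : c ≠ 0) (h1 : c ≠ 1) : P = ⊥ ∨ P = ⊤ := by
  by_cases hne : P = ⊥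
  · exact Or.inl hne
  · right
    have := hP.raise_one h0 (hP.one_mem hp hne)
    exact hP.eq_top_of_y_mem h1 (hP.lower (by omega) (by omega) (by omega) (by omega) this)

end DensStable

/-- In weight zero `y` still generates everything. A monomial involving `y` lowers to `y`; a
positive power of `x` lowers to `x`, which `hamA p k 2` sends to `2 y`. -/
theorem DensStable.eq_top_of_nonconstant (hp : 5 ≤ p) {P : Submodule k (Trunc p k)}
    (hP : DensStable 0 P) {f : Trunc p k} (hf : f ∈ P) (h : f ∉ Submodule.span k {1}) : P = ⊤ := by
  by_contra hne
  have hy : tx p k ^ 0 * ty p k ^ 1 ∉ P := fun h => hne (hP.eq_top_of_y_mem zero_ne_one h)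
  refine h (mem_of_coef fun i hi j hj hij => ?_)
  have hm := hP.monomial_mem hp hf hi hj hij
  obtain rfl : j = 0 := by
    by_contra h0
    exact hy (hP.lower hi hj (by omega) (by omega) hm)
  obtain rfl : i = 0 := by
    by_contra h0
    have h1 := hP _ (hamA_mem (j := 2) (by omega)) _
      (hP.lower (i := 1) (j := 0) hi hj (by omega) le_rfl hm)
    rw [densHom_hamA_pos _ two_pos one_pos, P.smul_mem_iff] at h1
    · exact hy h1
    · rw [Nat.cast_one, mul_one]
      exact natCast_ne_zero_of_lt (by omega) (by omega)
  rw [pow_zero, pow_zero, one_mul]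
  exact Submodule.mem_span_singleton_self 1

/-- These are the two monomials directly below the top one, and every monomial other than the top
one divides one of them. The second comes from the first by `hamA p k 2`. -/
theorem DensStable.mem_of_ne_bot (hp : 5 ≤ p) {P : Submodule k (Trunc p k)} (hP : DensStable 1 P)
    (hne : P ≠ ⊥) : tx p k ^ (p - 1) * ty p k ^ (p - 2) ∈ P ∧
      tx p k ^ (p - 2) * ty p k ^ (p - 1) ∈ P := by
  have h := hP.raise_one one_ne_zero (hP.one_mem hp hne)
  refine ⟨h, ?_⟩
  have h1 := hP _ (hamA_mem (j := 2) (by omega)) _ h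
  rw [densHom_hamA_pos _ two_pos (by omega), P.smul_mem_iff] at h1
  · convert h1 using 3 <;> omega
  · exact mul_ne_zero (natCast_ne_zero_of_lt (by omega) (by omega))
      (natCast_ne_zero_of_lt (by omega) (by omega))

theorem DensStable.ker_le (hp : 5 ≤ p) {P : Submodule k (Trunc p k)} (hP : DensStable 1 P)
    (hne : P ≠ ⊥) : LinearMap.ker (coef (p := p) (k := k) (p - 1) (p - 1)) ≤ P := by
  intro f hf
  obtain ⟨h1, h2⟩ := hP.mem_of_ne_bot hp hne
  refine mem_of_coef fun i hi j hj hij => ?_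
  by_cases h : j ≤ p - 2
  · exact hP.lower (by omega) (by omega) (by omega) h h1
  · refine hP.lower (by omega) (by omega) ?_ (by omega) h2
    by_contra h'
    obtain rfl : i = p - 1 := by omega
    obtain rfl : j = p - 1 := by omega
    exact hij hf

/-- In weight one the action is a total divergence `∂x(f D x) + ∂y(f D y)`, and a derivative in a
variable has no term with exponent `p - 1` in that variable. -/
theorem coef_densHom_one (D : Witt p k) (f : Trunc p k) :
    coef (p - 1) (p - 1) (densHom (1 : k) D f) = 0 := by
  have hp := (Fact.out : p.Prime).pos
  have h : densHom (1 : k) D f =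
      partialD p k 0 (f * D (tx p k)) + partialD p k 1 (f * D (ty p k)) := by
    rw [densHom_apply, witt_apply, diverg_apply, one_smul, Derivation.leibniz, Derivation.leibniz]
    simp only [smul_eq_mul]
    ring
  rw [h, map_add, coef_partialD_zero, coef_partialD_one (by omega) (by omega),
    Nat.sub_add_cancel hp, CharP.cast_eq_zero k p, zero_mul, zero_add]

end DensSubmodules

/-! ### Stable spaces of 1-forms and generation by the top forms. -/

section FormSubmodules

variable {p : ℕ} [Fact p.Prime] {k : Type u} [Field k] [CharP k p]

/-- A space of `1`-forms stable under the Lie derivatives along `Ĥ`. -/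
def FormStable (P : Submodule k (Trunc p k × Trunc p k)) : Prop :=
  ∀ D ∈ Hhat p k, ∀ ω ∈ P, formHom D ω ∈ P

namespace FormStable

variable {P : Submodule k (Trunc p k × Trunc p k)} (hP : FormStable P)
include hP

theorem comap_dZero : DensStable 0 (P.comap (dZero p k)) := by
  intro D hD f hf
  rw [Submodule.mem_comap, map_zero, dZero_equivariant]
  exact hP D hD _ hf

theorem map_dOne : DensStable 1 (P.map (dOne p k)) := by
  rintro D hD _ ⟨ω, hω, rfl⟩
  rw [map_one, ← dOne_equivariant]
  exact Submodule.mem_map_of_mem (hP D hD _ hω)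

/-- Both `hamA p k 1` and `∂y` send `x` to a constant, so they lower the coefficient of `dx` freely.
The image of `y` under `hamA p k 1` is not constant, but in front of `x^i` with `i > 0` its
differential contributes only a multiple of `dx`; hence the forms `f dx` are treated before the
forms `f dy`. -/
theorem eq_top_of_top_mem
    (hx : formMul (tx p k ^ (p - 1) * ty p k ^ (p - 1)) (tx p k) ∈ P)
    (hy : formMul (tx p k ^ (p - 1) * ty p k ^ (p - 1)) (ty p k) ∈ P) : P = ⊤ := by
  have hp := (Fact.out : p.Prime).two_le
  have ha : ∀ i j : ℕ, 0 < i → hamA p k 1 (tx p k ^ i * ty p k ^ j) =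
      (i : k) • (tx p k ^ (i - 1) * ty p k ^ j) := by
    intro i j hi
    have := densHom_hamA_pos (p := p) (0 : k) (b := j) one_pos hi
    simpa [densHom_apply] using this
  have mem_x : ∀ f, formMul f (tx p k) ∈ P := by
    have h : P.comap (formMul.flip (tx p k)) = ⊤ := by
      refine eq_top_of_monomials fun i hi j hj => ?_
      refine lowering_induction (p := p)
        (P := fun i j => formMul (tx p k ^ i * ty p k ^ j) (tx p k) ∈ P) ?_ ?_
        (by omega) (by omega) (by omega) (by omega) hx
      · intro i j h0 hi hj h
        have := hP _ (hamA_mem (j := 1) (by omega)) _ h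
        rw [formHom_formMul, hamA_tx, ha i j h0] at this
        simp only [formMul_apply (_ * _) ((_ : k) • _), map_smul, LinearMap.smul_apply, pow_zero,
          Nat.sub_self, dZero_apply, Derivation.map_one_eq_zero, Prod.mk_zero_zero, smul_zero,
          add_zero] at this
        exact (P.smul_mem_iff (natCast_ne_zero_of_lt h0 hi)).1 this
      · intro i j h0 hi hj h
        have := hP _ (partialD_one_mem p k) _ h
        rw [formHom_formMul, partialD_one_tx, partialD_one_monomial, map_zero, add_zero, map_smul,
          LinearMap.smul_apply] at this
        exact (P.smul_mem_iff (natCast_ne_zero_of_lt h0 hj)).1 this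
    intro f
    have : f ∈ P.comap (formMul.flip (tx p k)) := by rw [h]; trivial
    exact this
  have mem_y : ∀ f, formMul f (ty p k) ∈ P := by
    have h : P.comap (formMul.flip (ty p k)) = ⊤ := by
      refine eq_top_of_monomials fun i hi j hj => ?_
      refine lowering_induction (p := p)
        (P := fun i j => formMul (tx p k ^ i * ty p k ^ j) (ty p k) ∈ P) ?_ ?_
        (by omega) (by omega) (by omega) (by omega) hy
      · intro i j h0 hi hj h
        have := hP _ (hamA_mem (j := 1) (by omega)) _ h
        rw [formHom_formMul, hamA_ty, ha i j h0, form_eq (formMul _ (-_))] at this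
        have h2 : (formMul (tx p k ^ i * ty p k ^ j)
            (-(((p - 1).factorial : k)⁻¹ • (tx p k ^ (p - 1) * ty p k ^ 1)))).2 = 0 := by
          have hx : tx p k ^ i * tx p k ^ (p - 1) = 0 := by
            rw [← pow_add]; exact tx_pow_eq_zero (by omega)
          rw [formMul_eq]
          dsimp only
          rw [map_neg, Derivation.map_smul, partialD_one_monomial]
          simp only [mul_neg, mul_smul_comm, neg_eq_zero]
          rw [show tx p k ^ i * ty p k ^ j * (tx p k ^ (p - 1) * ty p k ^ (1 - 1)) =
            (tx p k ^ i * tx p k ^ (p - 1)) * (ty p k ^ j * ty p k ^ (1 - 1)) by ring, hx,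
            zero_mul, smul_zero, smul_zero]
        rw [h2, map_zero, LinearMap.zero_apply, add_zero,
          P.add_mem_iff_left (mem_x _), map_smul, LinearMap.smul_apply] at this
        exact (P.smul_mem_iff (natCast_ne_zero_of_lt h0 hi)).1 this
      · intro i j h0 hi hj h
        have := hP _ (partialD_one_mem p k) _ h
        rw [formHom_formMul, partialD_one_ty, partialD_one_monomial, formMul_apply _ 1,
          dZero_apply, Derivation.map_one_eq_zero, Derivation.map_one_eq_zero, Prod.mk_zero_zero,
          smul_zero, add_zero, map_smul, LinearMap.smul_apply] at this
        exact (P.smul_mem_iff (natCast_ne_zero_of_lt h0 hj)).1 this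
    intro f
    have : f ∈ P.comap (formMul.flip (ty p k)) := by rw [h]; trivial
    exact this
  rw [eq_top_iff]
  intro ω _
  rw [form_eq ω]
  exact P.add_mem (mem_x _) (mem_y _)

end FormStable

end FormSubmodules

theorem natCast_add_eq_zero_iff {p a m : ℕ} (ha : a < p) (hm : 0 < m) (hmp : m < p) :
    ((a : ZMod p) + m = 0) ↔ a = p - m := by
  rw [← Nat.cast_add, ZMod.natCast_eq_zero_iff]
  constructor
  · rintro ⟨n, hn⟩
    have h1 : n < 2 := by nlinarith
    interval_cases n <;> omega
  · rintro rfl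
    rw [Nat.sub_add_cancel hmp.le]

/-! ### The greatest proper submodule of the 1-forms. -/

section FormSimplicity

variable {p : ℕ} [Fact p.Prime] {k : Type u} [Field k] [CharP k p]

/-- The weights of the basis of `1`-forms with respect to `x ∂x` and `y ∂y`. -/
def formWt (p : ℕ) : Fin p × Fin p ⊕ Fin p × Fin p → ZMod p × ZMod p
  | Sum.inl ij => ((ij.1 : ℕ) + 1, (ij.2 : ℕ))
  | Sum.inr ij => ((ij.1 : ℕ), (ij.2 : ℕ) + 1)

/-- Weights of 1-forms need not be multiplicity free: the weight of `τ dx`, for the top monomial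
`τ`, is shared with `y^(p-2) dy` and no other basis form. -/
theorem formWt_eq_iff (hp : 5 ≤ p) (i : Fin p × Fin p ⊕ Fin p × Fin p) :
    ((formWt p i).1 = 0 ∧ (formWt p i).2 = -1) ↔
      i = Sum.inl (⟨p - 1, by omega⟩, ⟨p - 1, by omega⟩) ∨
      i = Sum.inr (⟨0, by omega⟩, ⟨p - 2, by omega⟩) := by
  have h1 : ∀ a : Fin p, ((a : ℕ) : ZMod p) + 1 = 0 ↔ a = ⟨p - 1, by omega⟩ := by
    intro a
    rw [Fin.ext_iff]
    exact_mod_cast natCast_add_eq_zero_iff (m := 1) a.2 (by omega) (by omega)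
  have h2 : ∀ a : Fin p, ((a : ℕ) : ZMod p) + 1 = -1 ↔ a = ⟨p - 2, by omega⟩ := by
    intro a
    rw [Fin.ext_iff, ← natCast_add_eq_zero_iff (m := 2) a.2 (by omega) (by omega), ← sub_eq_zero]
    push_cast
    ring_nf
  have h3 : ∀ a : Fin p, ((a : ℕ) : ZMod p) = 0 ↔ a = ⟨0, by omega⟩ := by
    intro a
    rw [Fin.ext_iff, ZMod.natCast_eq_zero_iff]
    exact ⟨fun h => Nat.eq_zero_of_dvd_of_lt h a.2, fun h => by rw [h]; exact dvd_zero p⟩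
  rcases i with ⟨a, b⟩ | ⟨a, b⟩
  · simp [formWt, h1, eq_neg_iff_add_eq_zero]
  · simp [formWt, h2, h3]

/-- The basis of `1`-forms. -/
abbrev formBasis (p : ℕ) (k : Type u) [Field k] :
    Module.Basis (Fin p × Fin p ⊕ Fin p × Fin p) k (Trunc p k × Trunc p k) :=
  (monoBasis p k).prod (monoBasis p k)

omit [Fact p.Prime] in
theorem formBasis_inl (ij : Fin p × Fin p) :
    formBasis p k (Sum.inl ij) = formMul (mono p k ij) (tx p k) := by
  simp [Module.Basis.prod_apply, formMul_eq]

omit [Fact p.Prime] in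
theorem formBasis_inr (ij : Fin p × Fin p) :
    formBasis p k (Sum.inr ij) = formMul (mono p k ij) (ty p k) := by
  simp [Module.Basis.prod_apply, formMul_eq]

omit [Fact p.Prime] in
theorem formHom_euler_x (i : Fin p × Fin p ⊕ Fin p × Fin p) :
    formHom (tx p k • partialD p k 0) (formBasis p k i) =
      ZMod.castHom dvd_rfl k (formWt p i).1 • formBasis p k i := by
  have h : ∀ a b : ℕ, tx p k * ((a : k) • (tx p k ^ (a - 1) * ty p k ^ b)) =
      (a : k) • (tx p k ^ a * ty p k ^ b) := by
    rintro (_ | a) b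
    · simp
    · rw [Nat.add_sub_cancel, pow_succ', mul_smul_comm, mul_assoc]
  rcases i with ⟨a, b⟩ | ⟨a, b⟩
  · rw [formBasis_inl, formHom_formMul, mono, Derivation.smul_apply, partialD_zero_monomial,
      smul_eq_mul, h, Derivation.smul_apply, partialD_zero_tx, smul_eq_mul, mul_one, map_smul,
      LinearMap.smul_apply]
    simp [formWt, add_smul]
  · rw [formBasis_inr, formHom_formMul, mono, Derivation.smul_apply, partialD_zero_monomial,
      smul_eq_mul, h, Derivation.smul_apply, partialD_zero_ty, smul_zero, map_zero, add_zero,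
      map_smul, LinearMap.smul_apply]
    simp [formWt]

omit [Fact p.Prime] in
theorem formHom_euler_y (i : Fin p × Fin p ⊕ Fin p × Fin p) :
    formHom (ty p k • partialD p k 1) (formBasis p k i) =
      ZMod.castHom dvd_rfl k (formWt p i).2 • formBasis p k i := by
  have h : ∀ a b : ℕ, ty p k * ((b : k) • (tx p k ^ a * ty p k ^ (b - 1))) =
      (b : k) • (tx p k ^ a * ty p k ^ b) := by
    rintro a (_ | b)
    · simp
    · rw [Nat.add_sub_cancel, pow_succ', mul_smul_comm, mul_left_comm]
  rcases i with ⟨a, b⟩ | ⟨a, b⟩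
  · rw [formBasis_inl, formHom_formMul, mono, Derivation.smul_apply, partialD_one_monomial,
      smul_eq_mul, h, Derivation.smul_apply, partialD_one_tx, smul_zero, map_zero, add_zero,
      map_smul, LinearMap.smul_apply]
    simp [formWt]
  · rw [formBasis_inr, formHom_formMul, mono, Derivation.smul_apply, partialD_one_monomial,
      smul_eq_mul, h, Derivation.smul_apply, partialD_one_ty, smul_eq_mul, mul_one, map_smul,
      LinearMap.smul_apply]
    simp [formWt, add_smul]

namespace FormStable

variable {P : Submodule k (Trunc p k × Trunc p k)} (hP : FormStable P)
include hP

theorem weight_mem (hp : 5 ≤ p) {ω : Trunc p k × Trunc p k} (hω : ω ∈ P) :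
    coef (p - 1) (p - 1) ω.1 • formMul (tx p k ^ (p - 1) * ty p k ^ (p - 1)) (tx p k) +
      coef 0 (p - 2) ω.2 • formMul (tx p k ^ 0 * ty p k ^ (p - 2)) (ty p k) ∈ P := by
  classical
  obtain ⟨hX, hY⟩ := euler_mem (p := p) (k := k) hp
  have h := weight_component_mem₂ (formBasis p k) formHom_euler_x formHom_euler_y
    (hP _ hX) (hP _ hY) hω 0 (-1)
  rw [show (Finset.univ.filter fun i => (formWt p i).1 = 0 ∧ (formWt p i).2 = -1) =
      {Sum.inl (⟨p - 1, by omega⟩, ⟨p - 1, by omega⟩), Sum.inr (⟨0, by omega⟩, ⟨p - 2, by omega⟩)}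
      by ext i; simp [formWt_eq_iff hp], Finset.sum_pair (by simp), formBasis_inl,
    formBasis_inr, Module.Basis.prod_repr_inl, Module.Basis.prod_repr_inr, ← coef_eq_repr,
    ← coef_eq_repr] at h
  exact h

theorem eq_top_of_not_le_ker (hp : 5 ≤ p) (h : ¬ P ≤ LinearMap.ker (dOne p k)) : P = ⊤ := by
  set τ := tx p k ^ (p - 1) * ty p k ^ (p - 1)
  have hne : P.map (dOne p k) ≠ ⊥ := fun h0 =>
    h fun ω hω => (Submodule.mem_bot k).1 (h0 ▸ Submodule.mem_map_of_mem hω)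
  obtain ⟨ω, hω, hd⟩ := (hP.map_dOne.mem_of_ne_bot hp hne).1
  -- In `dω` the derivative `∂x` never yields the exponent `p - 1` of `x`, so the coefficient of
  -- `x^(p-1) y^(p-2)` stems from the term `τ dx` of `ω` alone.
  have h1 : coef (p - 1) (p - 1) ω.1 ≠ 0 := by
    intro h0
    have := congrArg (coef (p - 1) (p - 2)) hd
    rw [dOne_apply, map_sub, coef_partialD_zero, coef_partialD_one (by omega) (by omega),
      show p - 2 + 1 = p - 1 by omega, h0, coef_monomial (by omega) (by omega) (by omega)
      (by omega)] at this
    simp at this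
  -- The weight component is `α τ dx + β y^(p-2) dy` with `α ≠ 0`; the second term has to be
  -- removed.
  have hw := hP.weight_mem hp hω
  set α := coef (p - 1) (p - 1) ω.1
  set β := coef 0 (p - 2) ω.2
  have hformHom : ∀ D f, formHom D (dZero p k f) = dZero p k (D f) := fun D f => by
    rw [← dZero_equivariant]; simp [densHom_apply]
  have hdy : dZero p k (ty p k ^ (p - 1)) =
      ((p - 1 : ℕ) : k) • formMul (tx p k ^ 0 * ty p k ^ (p - 2)) (ty p k) := by
    have := partialD_one_monomial (p := p) (k := k) 0 (p - 1)
    have h0 := partialD_zero_monomial (p := p) (k := k) 0 (p - 1)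
    rw [pow_zero, one_mul] at this h0
    rw [dZero_apply, this, h0, formMul_eq]
    simp [Nat.sub_sub]
  have hp1 : ((p - 1 : ℕ) : k) ≠ 0 := natCast_ne_zero_of_lt (by omega) (by omega)
  have hdx : formMul τ (tx p k) ∈ P := by
    by_cases hβ : β = 0
    · rwa [hβ, zero_smul, add_zero, P.smul_mem_iff h1] at hw
    -- The field `3 x² ∂y` kills `τ dx` and turns `y^(p-2) dy`, a multiple of `d(y^(p-1))`, into a
    -- nonzero multiple of `d(x² y^(p-2))`. Functions with differential in `P` form a stable space
    -- which now has a nonconstant member, so all exact forms lie in `P`, and `y^(p-2) dy` can be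
    -- subtracted.
    · have hD := hP _ (hamB_mem (i := 3) (j := 0) (by omega) (by omega) (by omega)) _ hw
      have hDx : hamB p k 3 0 (tx p k) = 0 := by simp [hamB]
      have hDf : ∀ f, hamB p k 3 0 f = (3 : k) • (tx p k ^ 2 * partialD p k 1 f) := by
        intro f; simp [hamB]
      have hDτ : hamB p k 3 0 τ = 0 := by
        rw [hDf, partialD_one_monomial, mul_smul_comm, ← mul_assoc, ← pow_add,
          tx_pow_eq_zero (by omega), zero_mul, smul_zero, smul_zero]
      have hDy : hamB p k 3 0 (ty p k ^ (p - 1)) =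
          ((3 : k) * (p - 1 : ℕ)) • (tx p k ^ 2 * ty p k ^ (p - 2)) := by
        have := partialD_one_monomial (p := p) (k := k) 0 (p - 1)
        rw [pow_zero, one_mul] at this
        rw [hDf, this, mul_smul_comm, smul_smul]
        simp [Nat.sub_sub]
      rw [map_add, map_smul, map_smul, formHom_formMul, hDx, hDτ, map_zero, map_zero,
        LinearMap.zero_apply, add_zero, smul_zero, zero_add, P.smul_mem_iff hβ,
        ← P.smul_mem_iff hp1, ← map_smul, ← hdy, hformHom, hDy, map_smul, P.smul_mem_iff] at hD
      · have htop := hP.comap_dZero.eq_top_of_nonconstant hp (f := tx p k ^ 2 * ty p k ^ (p - 2))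
          hD (by
            intro hmem
            obtain ⟨c, hc⟩ := Submodule.mem_span_singleton.1 hmem
            have := congrArg (coef 2 (p - 2)) hc
            rw [show (1 : Trunc p k) = tx p k ^ 0 * ty p k ^ 0 by simp, map_smul,
              coef_monomial (by omega) (by omega) (by omega) (by omega),
              coef_monomial (by omega) (by omega) (by omega) (by omega)] at this
            simp at this)
        have hy : ty p k ^ (p - 1) ∈ P.comap (dZero p k) := by rw [htop]; trivial
        rw [Submodule.mem_comap, hdy, P.smul_mem_iff hp1] at hy
        rwa [P.add_mem_iff_left (P.smul_mem _ hy), P.smul_mem_iff h1] at hw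
      · refine mul_ne_zero ?_ hp1
        exact_mod_cast natCast_ne_zero_of_lt (p := p) (k := k) (n := 3) (by omega) (by omega)
  refine hP.eq_top_of_top_mem hdx ?_
  -- The part `2 y ∂x` of `hamA p k 2` carries `dx` to `2 dy`, while `τ` is annihilated because `y^p
  -- = 0`.
  have hD := hP _ (hamA_mem (j := 2) (by omega)) _ hdx
  have hDτ : hamA p k 2 τ = 0 := by
    have := densHom_hamA_pos (p := p) (0 : k) (j := 2) (a := p - 1) (b := p - 1) two_pos (by omega)
    rw [ty_pow_eq_zero (by omega : p ≤ p - 1 + 2 - 1), mul_zero, smul_zero] at this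
    rwa [densHom_apply, zero_smul, add_zero] at this
  rw [formHom_formMul, hDτ, hamA_tx, map_zero, LinearMap.zero_apply, zero_add, map_smul,
    P.smul_mem_iff (natCast_ne_zero_of_lt (by omega) (by omega))] at hD
  simpa using hD

end FormStable

end FormSimplicity

/-! ### The maximal ideal and the top monomial. -/

section MaximalIdeal

variable {p : ℕ} [Fact p.Prime] {k : Type u} [Field k]

omit [Fact p.Prime] in
theorem monomial_mem_maxId {i j : ℕ} (h : ¬ (i = 0 ∧ j = 0)) :
    tx p k ^ i * ty p k ^ j ∈ maxId p k := by
  have hx : tx p k ∈ maxId p k := Ideal.subset_span (by simp)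
  have hy : ty p k ∈ maxId p k := Ideal.subset_span (by simp)
  by_cases hi : i = 0
  · exact Ideal.mul_mem_left _ _ (Ideal.pow_mem_of_mem _ hy _ (by omega))
  · exact Ideal.mul_mem_right _ _ (Ideal.pow_mem_of_mem _ hx _ (by omega))

theorem sub_const_mem_maxId (f : Trunc p k) : ∃ c : k, f - c • (1 : Trunc p k) ∈ maxId p k := by
  have hp := (Fact.out : p.Prime).pos
  refine ⟨coef 0 0 f, ?_⟩
  rw [← Submodule.restrictScalars_mem k]
  refine mem_of_coef fun i hi j hj hij => ?_
  rw [Submodule.restrictScalars_mem]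
  refine monomial_mem_maxId ?_
  rintro ⟨rfl, rfl⟩
  refine hij ?_
  rw [show (1 : Trunc p k) = tx p k ^ 0 * ty p k ^ 0 by simp, map_sub, map_smul,
    coef_monomial hp hp hp hp]
  simp

theorem sub_linear_mem_maxId_sq {f : Trunc p k} (hf : f ∈ maxId p k) :
    ∃ α β : k, f - (α • tx p k + β • ty p k) ∈ maxId p k ^ 2 := by
  obtain ⟨g, h, rfl⟩ := Ideal.mem_span_pair.1 hf
  obtain ⟨α, hα⟩ := sub_const_mem_maxId g
  obtain ⟨β, hβ⟩ := sub_const_mem_maxId h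
  refine ⟨α, β, ?_⟩
  have : g * tx p k + h * ty p k - (α • tx p k + β • ty p k) =
      (g - α • (1 : Trunc p k)) * tx p k + (h - β • (1 : Trunc p k)) * ty p k := by
    rw [sub_mul, sub_mul, smul_one_mul, smul_one_mul]
    ring
  rw [this, sq]
  exact Ideal.add_mem _ (Ideal.mul_mem_mul hα (Ideal.subset_span (by simp)))
    (Ideal.mul_mem_mul hβ (Ideal.subset_span (by simp)))

variable (p k) in
/-- The monomial of highest degree. -/
def topMono : Trunc p k := tx p k ^ (p - 1) * ty p k ^ (p - 1)

theorem topMono_mul {f : Trunc p k} (hf : f ∈ maxId p k) : topMono p k * f = 0 := by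
  have hp := (Fact.out : p.Prime).pos
  obtain ⟨g, h, rfl⟩ := Ideal.mem_span_pair.1 hf
  have hx : tx p k ^ (p - 1) * tx p k = 0 := by
    rw [← pow_succ, Nat.sub_add_cancel hp, tx_pow_char]
  have hy : ty p k ^ (p - 1) * ty p k = 0 := by
    rw [← pow_succ, Nat.sub_add_cancel hp, ty_pow_char]
  rw [topMono]
  linear_combination (g * ty p k ^ (p - 1)) * hx + (h * tx p k ^ (p - 1)) * hy

variable [CharP k p]

/-- Since `τ` kills the maximal ideal, both terms of `τ d(ab)` vanish for `a`, `b` in it. So `τ df`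
depends only on the class of `f` modulo the square. -/
theorem formMul_topMono_eq_zero {f : Trunc p k} (hf : f ∈ maxId p k ^ 2) :
    formMul (topMono p k) f = 0 := by
  rw [sq] at hf
  induction hf using Submodule.mul_induction_on' with
  | mem_mul_mem a ha b hb =>
    have h : ∀ i, topMono p k * partialD p k i (a * b) = 0 := by
      intro i
      rw [Derivation.leibniz, smul_eq_mul, smul_eq_mul]
      linear_combination partialD p k i b * topMono_mul ha + partialD p k i a * topMono_mul hb
    rw [formMul_eq, h, h, Prod.mk_zero_zero]
  | add a _ b _ ha hb => rw [map_add, ha, hb, add_zero]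

omit [Fact p.Prime] in
theorem mem_wittFil_zero {D : Witt p k} :
    D ∈ wittFil p k 0 ↔ D (tx p k) ∈ maxId p k ∧ D (ty p k) ∈ maxId p k := by
  constructor
  · intro h
    exact ⟨by simpa using h (tx p k), by simpa using h (ty p k)⟩
  · rintro ⟨h1, h2⟩ f
    rw [zero_add, pow_one, witt_apply]
    exact Ideal.add_mem _ (Ideal.mul_mem_right _ _ h1) (Ideal.mul_mem_right _ _ h2)

/-- Differentiate `τ D x = 0` by `∂x` and `τ D y = 0` by `∂y`, and add. -/
theorem apply_topMono {D : Witt p k} (hD : D ∈ wittFil p k 0) :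
    D (topMono p k) = -(diverg p k D * topMono p k) := by
  obtain ⟨h1, h2⟩ := mem_wittFil_zero.1 hD
  have hx := congrArg (partialD p k 0) (topMono_mul h1)
  have hy := congrArg (partialD p k 1) (topMono_mul h2)
  rw [Derivation.leibniz, map_zero, smul_eq_mul, smul_eq_mul] at hx hy
  rw [witt_apply, diverg_apply]
  linear_combination hx + hy

end MaximalIdeal

/-! ### The graded pieces of degrees zero and one. -/

section Graded

variable (p : ℕ) [Fact p.Prime] (k : Type u) [Field k]

/-- The class of `1` in degree zero. -/
def grOne : Gr p k 0 := Submodule.Quotient.mk ⟨1, by simp⟩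

/-- The class of `x` in degree one. -/
def grX : Gr p k 1 := Submodule.Quotient.mk ⟨tx p k, by
  rw [Submodule.restrictScalars_mem, pow_one]; exact Ideal.subset_span (by simp)⟩

/-- The class of `y` in degree one. -/
def grY : Gr p k 1 := Submodule.Quotient.mk ⟨ty p k, by
  rw [Submodule.restrictScalars_mem, pow_one]; exact Ideal.subset_span (by simp)⟩

/-- Multiplication with the top monomial. -/
def grTop : Gr p k 0 →ₗ[k] Trunc p k :=
  Submodule.liftQ _ (LinearMap.mulLeft k (topMono p k) ∘ₗ (maxPow p k 0).subtype) fun f hf => by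
    have hf' : (f : Trunc p k) ∈ maxId p k ^ (0 + 1) := hf
    exact topMono_mul (by simpa using hf')

theorem grTop_mk (f : maxPow p k 0) :
    grTop p k (Submodule.Quotient.mk f) = topMono p k * (f : Trunc p k) := rfl

/-- The map sending the class of `f` to `τ df`, for the top monomial `τ`. -/
def grForm [CharP k p] : Gr p k 1 →ₗ[k] Trunc p k × Trunc p k :=
  Submodule.liftQ _ (formMul (topMono p k) ∘ₗ (maxPow p k 1).subtype) fun f hf => by
    have hf' : (f : Trunc p k) ∈ maxId p k ^ 2 := hf
    exact formMul_topMono_eq_zero hf'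

theorem grForm_mk [CharP k p] (f : maxPow p k 1) :
    grForm p k (Submodule.Quotient.mk f) = formMul (topMono p k) (f : Trunc p k) := rfl

variable {p k}

theorem gr_zero_eq_smul (v : Gr p k 0) : ∃ c : k, c • grOne p k = v := by
  obtain ⟨⟨f, hf⟩, rfl⟩ := Submodule.Quotient.mk_surjective _ v
  obtain ⟨c, hc⟩ := sub_const_mem_maxId f
  refine ⟨c, ?_⟩
  rw [grOne, ← Submodule.Quotient.mk_smul, eq_comm, Submodule.Quotient.eq]
  change f - c • (1 : Trunc p k) ∈ maxId p k ^ (0 + 1)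
  simpa using hc

theorem finrank_gr_zero_le : Module.finrank k (Gr p k 0) ≤ 1 :=
  finrank_le_one (grOne p k) gr_zero_eq_smul

omit [Fact p.Prime] in
theorem gr_one_mk_eq {f : Trunc p k} (hf : f ∈ maxPow p k 1) {α β : k}
    (h : f - (α • tx p k + β • ty p k) ∈ maxId p k ^ 2) :
    (Submodule.Quotient.mk ⟨f, hf⟩ : Gr p k 1) = α • grX p k + β • grY p k := by
  rw [grX, grY, ← Submodule.Quotient.mk_smul, ← Submodule.Quotient.mk_smul,
    ← Submodule.Quotient.mk_add, Submodule.Quotient.eq]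
  exact h

variable [CharP k p]

/-- The map `grForm` sends the two classes to `τ dx` and `τ dy`, which are visibly independent. -/
theorem linearIndependent_gr_one : LinearIndependent k ![grX p k, grY p k] := by
  have hp := (Fact.out : p.Prime).pos
  refine LinearIndependent.of_comp (grForm p k) ?_
  have h0 : topMono p k ≠ 0 := monomial_ne_zero (by omega) (by omega)
  have h : grForm p k ∘ ![grX p k, grY p k] = ![(topMono p k, 0), (0, topMono p k)] := by
    ext i : 1
    fin_cases i <;> simp [grX, grY, grForm_mk, formMul_eq]
  rw [h, LinearIndependent.pair_iff' (by simp [h0])]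
  intro a ha
  simp [h0.symm] at ha

omit [CharP k p] in
theorem span_gr_one : ⊤ ≤ Submodule.span k (Set.range ![grX p k, grY p k]) := by
  rintro v -
  obtain ⟨⟨f, hf⟩, rfl⟩ := Submodule.Quotient.mk_surjective _ v
  obtain ⟨α, β, h⟩ := sub_linear_mem_maxId_sq (f := f) (by simpa using hf)
  rw [gr_one_mk_eq hf h]
  refine Submodule.add_mem _ (Submodule.smul_mem _ _ (Submodule.subset_span ⟨0, rfl⟩))
    (Submodule.smul_mem _ _ (Submodule.subset_span ⟨1, rfl⟩))

variable (p k) in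
/-- The basis of the degree one part given by the classes of `x` and `y`. -/
def grBasis : Module.Basis (Fin 2) k (Gr p k 1) :=
  Module.Basis.mk linearIndependent_gr_one span_gr_one

theorem finrank_gr_one : Module.finrank k (Gr p k 1) = 2 := by
  rw [Module.finrank_eq_card_basis (grBasis p k), Fintype.card_fin]

/-- Multiplication by `τ` sees only the constant term of the divergence, which is the trace on `(x,
y) / (x, y)²`. -/
theorem diverg_mul_topMono (D : wittFil p k 0) :
    diverg p k (D : Witt p k) * topMono p k = linTrace D • topMono p k := by
  obtain ⟨h1, h2⟩ := mem_wittFil_zero.1 D.2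
  obtain ⟨α, β, hx⟩ := sub_linear_mem_maxId_sq h1
  obtain ⟨γ, δ, hy⟩ := sub_linear_mem_maxId_sq h2
  have b0 : grBasis p k 0 = grX p k := by simp [grBasis]
  have b1 : grBasis p k 1 = grY p k := by simp [grBasis]
  have e0 : grHom 1 D (grX p k) = α • grX p k + β • grY p k := gr_one_mk_eq _ hx
  have e1 : grHom 1 D (grY p k) = γ • grX p k + δ • grY p k := gr_one_mk_eq _ hy
  have htr : linTrace D = α + δ := by
    rw [linTrace, LinearMap.trace_eq_matrix_trace k (grBasis p k), Matrix.trace_fin_two,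
      LinearMap.toMatrix_apply, LinearMap.toMatrix_apply, b0, b1, e0, e1, ← b0, ← b1]
    simp
  have f0 := congrArg Prod.fst (formMul_topMono_eq_zero hx)
  have f1 := congrArg Prod.snd (formMul_topMono_eq_zero hy)
  simp only [formMul_eq, map_sub, map_add, Derivation.map_smul, partialD_zero_tx,
    partialD_zero_ty, partialD_one_tx, partialD_one_ty, smul_zero, add_zero, zero_add,
    Prod.fst_zero, Prod.snd_zero, Prod.fst_sub, Prod.fst_add, Prod.snd_sub,
    Prod.snd_add, mul_zero, mul_smul_comm, mul_one, sub_eq_zero] at f0 f1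
  rw [htr, diverg_apply, add_smul, ← f0, ← f1]
  ring

theorem apply_topMono_eq (D : wittFil p k 0) :
    (D : Witt p k) (topMono p k) = -(linTrace D • topMono p k) := by
  rw [apply_topMono D.2, diverg_mul_topMono]

end Graded

/-! ### A complement of `Ĥ_(0)` in `Ĥ` and its `p`-th powers. -/

section Decomposition

variable {p : ℕ} [Fact p.Prime] {k : Type u} [Field k] [CharP k p]

/-- For `A = hamA p k 1` the power `A^p` is again a derivation, so only `x` and `y` need checking.
Here `A x = 1` gives `A^p x = 0`, while `A y = -x^(p-1) y / (p-1)!` and `p - 1` further lowerings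
give `A^p y = -y`. -/
theorem hamA_one_iterate_apply (f : Trunc p k) :
    (-(ty p k • partialD p k 1)) f = (⇑(hamA p k 1))^[p] f := by
  have hp := (Fact.out : p.Prime).two_le
  set A := hamA p k 1 with hA
  have hpow : ∀ (n : ℕ) (f : Trunc p k), (⇑A)^[n] f = ((A : Trunc p k →ₗ[k] Trunc p k) ^ n) f :=
    fun n f => (witt_pow_apply A n f).symm
  have hleib : ∀ a b : Trunc p k, ((A : Trunc p k →ₗ[k] Trunc p k) ^ p) (a * b) =
      a • ((A : Trunc p k →ₗ[k] Trunc p k) ^ p) b + b • ((A : Trunc p k →ₗ[k] Trunc p k) ^ p) a := by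
    intro a b
    have := leibniz_pow_char p (LinearMap.mul k (Trunc p k))
      (R := (A : Trunc p k →ₗ[k] Trunc p k)) (S := (A : Trunc p k →ₗ[k] Trunc p k))
      (T := (A : Trunc p k →ₗ[k] Trunc p k)) (fun a b => by
        simp only [LinearMap.mul_apply', Derivation.coeFn_coe, Derivation.leibniz, smul_eq_mul]
        ring) a b
    simp only [LinearMap.mul_apply'] at this
    rw [this, smul_eq_mul, smul_eq_mul]
    ring
  have hit : ∀ (m : ℕ) {n : ℕ} (_ : m + 1 = n) (f : Trunc p k), (⇑A)^[n] f = (⇑A)^[m] (A f) := by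
    rintro m _ rfl f
    exact Function.iterate_succ_apply _ _ _
  have key : -(ty p k • partialD p k 1) = Derivation.mk' ((A : Trunc p k →ₗ[k] Trunc p k) ^ p) hleib := by
    refine witt_ext ?_ ?_
    · rw [Derivation.coe_mk', ← hpow, hit (p - 2 + 1) (by omega), hit (p - 2) rfl]
      simp [hA, hamA_tx]
    · have hstep : ∀ m < p, (⇑A)^[m] (tx p k ^ m * ty p k ^ 1) =
          (m.factorial : k) • (tx p k ^ 0 * ty p k ^ 1) := by
        intro m
        induction m with
        | zero => simp
        | succ m ih =>
          intro hm
          have h1 := densHom_hamA_pos (p := p) (0 : k) (a := m + 1) (b := 1) one_pos (by omega)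
          rw [densHom_apply, zero_smul, add_zero] at h1
          rw [Function.iterate_succ_apply, h1, Nat.add_sub_cancel, Nat.add_sub_cancel, hpow,
            map_smul, ← hpow, ih (by omega), smul_smul, Nat.factorial_succ, Nat.cast_mul,
            Nat.cast_one, one_mul]
      have h2 : (p - 1) + 1 = p := by omega
      rw [Derivation.coe_mk', ← hpow, hit _ h2, hA, hamA_ty, ← hA, hpow, map_neg, map_smul, ← hpow,
        hstep _ (by omega), smul_smul, inv_mul_cancel₀ (factorial_ne_zero_of_lt (by omega))]
      simp
  rw [key, Derivation.coe_mk', hpow]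

theorem neg_euler_y_mem (hp : 5 ≤ p) : -(ty p k • partialD p k 1) ∈ Hhat0 p k := by
  refine ⟨(Hhat p k).neg_mem (euler_mem hp).2, mem_wittFil_zero.2 ⟨?_, ?_⟩⟩
  · simp
  · simpa using Ideal.subset_span (by simp)

/-- The constant terms of `D x` and `D y` are removed by `hamA p k 1` and `∂y`; the former sends `y`
into the maximal ideal and so does not disturb the second condition. -/
theorem hhat_decomposition {D : Witt p k} (hD : D ∈ Hhat p k) : ∃ E ∈ Hhat0 p k, ∃ α β : k,
    D = E + α • hamA p k 1 + β • partialD p k 1 := by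
  have hp := (Fact.out : p.Prime).two_le
  obtain ⟨α, hα⟩ := sub_const_mem_maxId (D (tx p k))
  obtain ⟨β, hβ⟩ := sub_const_mem_maxId (D (ty p k))
  refine ⟨D - α • hamA p k 1 - β • partialD p k 1, ⟨?_, ?_⟩, α, β, by abel⟩
  · exact (Hhat p k).sub_mem ((Hhat p k).sub_mem hD ((Hhat p k).smul_mem _ (hamA_mem (by omega))))
      ((Hhat p k).smul_mem _ (partialD_one_mem p k))
  · refine mem_wittFil_zero.2 ⟨?_, ?_⟩
    · simpa [hamA_tx] using hα
    · have h : (D - α • hamA p k 1 - β • partialD p k 1) (ty p k) =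
          (D (ty p k) - β • (1 : Trunc p k)) + (α * ((p - 1).factorial : k)⁻¹) •
            (tx p k ^ (p - 1) * ty p k ^ 1) := by
        simp only [Derivation.sub_apply, Derivation.smul_apply, hamA_ty, partialD_one_ty,
          smul_neg, smul_smul]
        ring
      rw [h]
      exact Ideal.add_mem _ hβ (Submodule.smul_of_tower_mem _ _ (monomial_mem_maxId (by simp)))

end Decomposition

/-! ### Induced modules as densities and as 1-forms. -/

section InducedModules

variable (p : ℕ) [Fact p.Prime] (k : Type u) [Field k] [CharP k p]

/-- The representation of `u(Ĥ_(0))` on `Symⁿ(V) ⊗ det ^ b`. -/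
def symRep (n : ℕ) (b : ZMod p) : ResEnv p (Hhat0 p k) →ₐ[k] Module.End k (Gr p k n) :=
  resLift p (Hhat0 p k) (simpleHom p k n b) fun D E h =>
    twistHom_pow (by rw [← map_pow, ZMod.pow_card])
      (D := LieSubalgebra.inclusion inf_le_right D) (E := LieSubalgebra.inclusion inf_le_right E) h

/-- The module induced from `Symⁿ(V) ⊗ det ^ b`. -/
abbrev IndMod (n : ℕ) (b : ZMod p) : Type u := Ind (resIncl p (Hhat0_le_Hhat p k)) (symRep p k n b)

variable {p k}

theorem symRep_resι (n : ℕ) (b : ZMod p) (D : Hhat0 p k) :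
    symRep p k n b (resι p (Hhat0 p k) D) = simpleHom p k n b D := resLift_resι _ _ D

section Lift

variable {M : Type u} [AddCommGroup M] [Module k M] [Module (UHat p k) M]
  [IsScalarTower k (UHat p k) M] {n : ℕ} {b : ZMod p}

/-- The homomorphism from the induced module determined by an `Ĥ_(0)`-equivariant linear map. -/
def indModLift (θ : Gr p k n →ₗ[k] M) (h : ∀ (D : Hhat0 p k) (v : Gr p k n),
    θ (simpleHom p k n b D v) =
      resι p (Hhat p k) (LieSubalgebra.inclusion (Hhat0_le_Hhat p k) D) • θ v) :
    IndMod p k n b →ₗ[UHat p k] M :=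
  indLift _ _ θ fun s => by
    induction s using resEnv_induction with
    | hc c => intro v; simp [algebraMap_smul]
    | hι D => intro v; rw [symRep_resι, h, resIncl_resι]
    | hadd x y hx hy => intro v; simp [hx, hy, add_smul]
    | hmul x y hx hy => intro v; simp [hx, hy, mul_smul]

theorem indModLift_indι (θ : Gr p k n →ₗ[k] M) (h : ∀ (D : Hhat0 p k) (v : Gr p k n),
    θ (simpleHom p k n b D v) =
      resι p (Hhat p k) (LieSubalgebra.inclusion (Hhat0_le_Hhat p k) D) • θ v) (v : Gr p k n) :
    indModLift θ h (indι (resIncl p (Hhat0_le_Hhat p k)) (symRep p k n b) v) = θ v :=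
  indLift_indι _ _ _ _ v

end Lift

variable (n : ℕ) (b : ZMod p)

theorem indMod_span (hp : 5 ≤ p) :
    Submodule.span k {m : IndMod p k n b | ∃ i j : Fin p,
      ∃ v ∈ LinearMap.range (indι (resIncl p (Hhat0_le_Hhat p k)) (symRep p k n b)),
      m = resι p (Hhat p k) ⟨partialD p k 1, partialD_one_mem p k⟩ ^ (i : ℕ) •
        resι p (Hhat p k) ⟨hamA p k 1, hamA_mem (by omega)⟩ ^ (j : ℕ) • v} = ⊤ := by
  set V := LinearMap.range (indι (resIncl p (Hhat0_le_Hhat p k)) (symRep p k n b))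
  set P := Submodule.span k {m : IndMod p k n b | ∃ i j : Fin p, ∃ v ∈ V,
      m = resι p (Hhat p k) ⟨partialD p k 1, partialD_one_mem p k⟩ ^ (i : ℕ) •
        resι p (Hhat p k) ⟨hamA p k 1, hamA_mem (by omega)⟩ ^ (j : ℕ) • v} with hPdef
  have hstab : ∀ (D : Hhat p k), ∀ m ∈ P, resι p (Hhat p k) D • m ∈ P := by
    intro D m hm
    refine span_pbw_stable (ι := resι p (Hhat p k)) resι_lie
      (g₀ := (Hhat0 p k).toSubmodule.comap (Hhat p k).toSubmodule.subtype) ?_ ?_ (by omega) ?_ ?_ D hm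
    · rintro ⟨D, hD⟩
      obtain ⟨E, hE, α, β, h⟩ := hhat_decomposition hD
      exact ⟨⟨E, Hhat0_le_Hhat p k hE⟩, hE, α, β, Subtype.ext h⟩
    · rintro D hD _ ⟨v, rfl⟩
      have h := smul_indι (resIncl p (Hhat0_le_Hhat p k)) (symRep p k n b)
        (resι p (Hhat0 p k) ⟨D, hD⟩) v
      rw [resIncl_resι] at h
      exact ⟨_, h.symm⟩
    · rw [resι_pow (E := 0), map_zero]
      intro f
      have h0 : ∀ i < p, ∀ j < p, ((partialD p k 1 : Trunc p k →ₗ[k] Trunc p k) ^ p)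
          (tx p k ^ i * ty p k ^ j) = 0 := by
        intro i _ j hj
        have : ∀ m, ∃ c : k, ((partialD p k 1 : Trunc p k →ₗ[k] Trunc p k) ^ m)
            (tx p k ^ i * ty p k ^ j) = c • (if m ≤ j then tx p k ^ i * ty p k ^ (j - m) else 0) := by
          intro m
          induction m with
          | zero => exact ⟨1, by simp⟩
          | succ m ih =>
            obtain ⟨c, hc⟩ := ih
            rw [pow_succ', Module.End.mul_apply, hc, map_smul]
            by_cases hm : m ≤ j
            · rw [if_pos hm, Derivation.coeFn_coe, partialD_one_monomial, smul_smul]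
              by_cases hm' : m + 1 ≤ j
              · exact ⟨_, by rw [if_pos hm', Nat.sub_sub]⟩
              · exact ⟨0, by simp [show j - m = 0 by omega]⟩
            · exact ⟨0, by rw [if_neg hm, map_zero, smul_zero, zero_smul]⟩
        obtain ⟨c, hc⟩ := this p
        rw [hc, if_neg (by omega), smul_zero]
      have := LinearMap.congr_fun (linearMap_ext_monomials (g := 0) h0) f
      rw [witt_pow_apply] at this
      exact this.symm
    · exact ⟨⟨_, Hhat0_le_Hhat p k (neg_euler_y_mem hp)⟩, neg_euler_y_mem hp,
        resι_pow hamA_one_iterate_apply⟩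
  have htop : stableSubmodule P hstab = ⊤ := by
    rw [eq_top_iff, ← span_range_indι, Submodule.span_le]
    rintro _ ⟨v, rfl⟩
    refine Submodule.subset_span ⟨⟨0, by omega⟩, ⟨0, by omega⟩, _, ⟨v, rfl⟩, ?_⟩
    simp
  rw [eq_top_iff]
  intro m _
  have : m ∈ stableSubmodule P hstab := by rw [htop]; trivial
  exact this

theorem finite_indMod_and_finrank_le (hp : 5 ≤ p) : Module.Finite k (IndMod p k n b) ∧
    Module.finrank k (IndMod p k n b) ≤ p ^ 2 * Module.finrank k (Gr p k n) := by
  classical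
  let u : Fin p × Fin p → UHat p k := fun ij =>
    resι p (Hhat p k) ⟨partialD p k 1, partialD_one_mem p k⟩ ^ (ij.1 : ℕ) *
      resι p (Hhat p k) ⟨hamA p k 1, hamA_mem (by omega)⟩ ^ (ij.2 : ℕ)
  let Φ : (Fin p × Fin p → Gr p k n) →ₗ[k] IndMod p k n b := ∑ ij,
    (Algebra.lsmul k k (IndMod p k n b) (u ij)) ∘ₗ
      indι (resIncl p (Hhat0_le_Hhat p k)) (symRep p k n b) ∘ₗ LinearMap.proj ij
  have hΦ : Function.Surjective Φ := by
    rw [← LinearMap.range_eq_top, eq_top_iff, ← indMod_span n b hp, Submodule.span_le]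
    rintro _ ⟨i, j, _, ⟨v, rfl⟩, rfl⟩
    refine ⟨Pi.single (i, j) v, ?_⟩
    rw [LinearMap.sum_apply, Finset.sum_eq_single (i, j)]
    · simp only [u, LinearMap.comp_apply, LinearMap.proj_apply, Pi.single_eq_same, Algebra.lsmul_coe,
        mul_smul]
    · intro ij _ hne
      simp [hne]
    · simp
  refine ⟨Module.Finite.of_surjective Φ hΦ, ?_⟩
  have := LinearMap.finrank_le_finrank_of_surjective hΦ
  rwa [Module.finrank_pi_fintype, Finset.sum_const, Finset.card_univ, Fintype.card_prod,
    Fintype.card_fin, smul_eq_mul, ← sq] at this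

/-- A surjection onto a module as large as the PBW bound must be injective, so the independence half
of the PBW theorem is not needed. -/
theorem nonempty_equiv_of_surjective (hp : 5 ≤ p) {M : Type u} [AddCommGroup M] [Module k M]
    [Module (UHat p k) M] [IsScalarTower k (UHat p k) M] (f : IndMod p k n b →ₗ[UHat p k] M)
    (hf : Function.Surjective f)
    (hM : p ^ 2 * Module.finrank k (Gr p k n) ≤ Module.finrank k M) :
    Nonempty (IndMod p k n b ≃ₗ[UHat p k] M) := by
  obtain ⟨hfin, hle⟩ := finite_indMod_and_finrank_le (k := k) n b hp
  have hf' : Function.Surjective (f.restrictScalars k) := hf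
  have h1 := LinearMap.finrank_le_finrank_of_surjective hf'
  have : Module.Finite k M := Module.Finite.of_surjective _ hf'
  have hinj := (LinearMap.injective_iff_surjective_of_finrank_eq_finrank
    (f := f.restrictScalars k) (by omega)).2 hf'
  exact ⟨LinearEquiv.ofBijective f ⟨hinj, hf⟩⟩

theorem densStable_subspaceOf {c : ZMod p} (M : Submodule (UHat p k) (Dens p k c)) :
    DensStable c (subspaceOf M) := by
  intro D hD f hf
  have := subspaceOf_stable (resι p (Hhat p k) ⟨D, hD⟩) hf
  rwa [densRep_resι] at this

theorem formStable_subspaceOf (M : Submodule (UHat p k) (Forms p k)) :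
    FormStable (subspaceOf M) := by
  intro D hD f hf
  have := subspaceOf_stable (resι p (Hhat p k) ⟨D, hD⟩) hf
  rwa [formRep_resι] at this

theorem finrank_dens (c : ZMod p) : Module.finrank k (Dens p k c) = p ^ 2 := by
  rw [← (toRepMod (densRep p k c)).finrank_eq, finrank_trunc]

theorem finrank_forms : Module.finrank k (Forms p k) = p ^ 2 * 2 := by
  rw [← (toRepMod (formRep p k)).finrank_eq, Module.finrank_prod, finrank_trunc, mul_two]

/-- The module induced from a one-dimensional module is a module of densities. -/
theorem nonempty_equiv_dens (hp : 5 ≤ p) :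
    Nonempty (IndMod p k 0 b ≃ₗ[UHat p k] Dens p k (b + 1)) := by
  let θ : Gr p k 0 →ₗ[k] Dens p k (b + 1) :=
    (toRepMod (densRep p k (b + 1))).toLinearMap ∘ₗ grTop p k
  have hθ : ∀ (D : Hhat0 p k) (v : Gr p k 0), θ (simpleHom p k 0 b D v) =
      resι p (Hhat p k) (LieSubalgebra.inclusion (Hhat0_le_Hhat p k) D) • θ v := by
    intro D v
    obtain ⟨f, rfl⟩ := Submodule.Quotient.mk_surjective _ v
    set D' : wittFil p k 0 := LieSubalgebra.inclusion inf_le_right D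
    have h1 : simpleHom p k 0 b D (Submodule.Quotient.mk f) = Submodule.Quotient.mk (powAct 0 D' f) +
        (ZMod.castHom dvd_rfl k b * linTrace D') • Submodule.Quotient.mk f := rfl
    have h2 : ((LieSubalgebra.inclusion (Hhat0_le_Hhat p k) D : Hhat p k) : Witt p k) = D' := rfl
    simp only [θ, LinearMap.comp_apply, LinearEquiv.coe_coe, smul_toRepMod, densRep_resι, h1, h2]
    congr 1
    -- The derivative of `τ` contributes `-tr(D)` and the density term `(b + 1) tr(D)`, leaving the
    -- twist by `b`.
    rw [map_add, map_smul, grTop_mk, grTop_mk, powAct_coe, densHom_apply, Derivation.leibniz,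
      apply_topMono_eq, ← mul_assoc, diverg_mul_topMono, map_add, map_one]
    simp only [smul_eq_mul, Algebra.smul_def, map_mul, map_add, map_one]
    ring
  refine nonempty_equiv_of_surjective 0 b hp (indModLift θ hθ) ?_ ?_
  · rw [← LinearMap.range_eq_top, ← subspaceOf_eq_top]
    refine (densStable_subspaceOf _).eq_top_of_top_mem ?_
    rw [mem_subspaceOf]
    refine ⟨indι _ _ (grOne p k), ?_⟩
    rw [indModLift_indι]
    simp [θ, grOne, grTop_mk, topMono]
  · rw [finrank_dens]
    exact (Nat.mul_le_mul_left _ finrank_gr_zero_le).trans (mul_one _).le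

/-- The module `Z(0, -1)` is the module of `1`-forms. -/
theorem nonempty_equiv_forms (hp : 5 ≤ p) :
    Nonempty (IndMod p k 1 (-1) ≃ₗ[UHat p k] Forms p k) := by
  let θ : Gr p k 1 →ₗ[k] Forms p k :=
    (toRepMod (formRep p k)).toLinearMap ∘ₗ grForm p k
  have hθ : ∀ (D : Hhat0 p k) (v : Gr p k 1), θ (simpleHom p k 1 (-1) D v) =
      resι p (Hhat p k) (LieSubalgebra.inclusion (Hhat0_le_Hhat p k) D) • θ v := by
    intro D v
    obtain ⟨f, rfl⟩ := Submodule.Quotient.mk_surjective _ v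
    set D' : wittFil p k 0 := LieSubalgebra.inclusion inf_le_right D
    have h1 : simpleHom p k 1 (-1) D (Submodule.Quotient.mk f) =
        Submodule.Quotient.mk (powAct 1 D' f) +
        (ZMod.castHom dvd_rfl k (-1) * linTrace D') • Submodule.Quotient.mk f := rfl
    have h2 : ((LieSubalgebra.inclusion (Hhat0_le_Hhat p k) D : Hhat p k) : Witt p k) = D' := rfl
    simp only [θ, LinearMap.comp_apply, LinearEquiv.coe_coe, smul_toRepMod, formRep_resι, h1, h2]
    congr 1
    -- Here the derivative of `τ` alone supplies the twist `-1`.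
    rw [map_add, map_smul, grForm_mk, grForm_mk, powAct_coe, formHom_formMul, apply_topMono_eq]
    simp only [map_neg, map_one, neg_mul, one_mul, map_smul, LinearMap.neg_apply,
      LinearMap.smul_apply, neg_smul]
    abel
  refine nonempty_equiv_of_surjective 1 (-1) hp (indModLift θ hθ) ?_ ?_
  · rw [← LinearMap.range_eq_top, ← subspaceOf_eq_top]
    refine (formStable_subspaceOf _).eq_top_of_top_mem ?_ ?_
    · rw [mem_subspaceOf]
      refine ⟨indι _ _ (grX p k), ?_⟩
      rw [indModLift_indι]
      simp [θ, grX, grForm_mk, topMono]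
    · rw [mem_subspaceOf]
      refine ⟨indι _ _ (grY p k), ?_⟩
      rw [indModLift_indι]
      simp [θ, grY, grForm_mk, topMono]
  · rw [finrank_forms, finrank_gr_one]

end InducedModules

/-! ### Modules with a greatest proper submodule. -/

section GreatestSubmodule

variable {R M D : Type*} [Ring R] [AddCommGroup M] [Module R M] [AddCommGroup D] [Module R D]

theorem isCoatom_of_greatest {K : Submodule R D} (hK : K ≠ ⊤) (h : ∀ N : Submodule R D, N ≠ ⊤ → N ≤ K) :
    IsCoatom K :=
  ⟨hK, fun N hN => by
    by_contra h'
    exact hN.not_ge (h N h')⟩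

theorem jacobson_eq_of_greatest {K : Submodule R D} (hK : K ≠ ⊤)
    (h : ∀ N : Submodule R D, N ≠ ⊤ → N ≤ K) : Module.jacobson R D = K :=
  le_antisymm (sInf_le (isCoatom_of_greatest hK h))
    (le_sInf fun N hN => ((hN.le_iff.1 (h N hN.1)).resolve_left hK).le)

/-- An isomorphism with a module with a greatest proper submodule `K` identifies the radical
with `K`. -/
theorem map_jacobson_of_greatest (e : M ≃ₗ[R] D) {K : Submodule R D} (hK : K ≠ ⊤)
    (h : ∀ N : Submodule R D, N ≠ ⊤ → N ≤ K) :
    (Module.jacobson R M).map (e : M →ₗ[R] D) = K := by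
  rw [Module.map_jacobson_of_bijective e.bijective, jacobson_eq_of_greatest hK h]

end GreatestSubmodule

/-! ### The trivial module and the radicals of the two exceptional modules. -/

section Trivial

variable {p : ℕ} [Fact p.Prime] {k : Type u} [Field k] [CharP k p]

instance : Module k (Triv p k) := inferInstanceAs (Module k k)

/-- The identity map from `k` to the trivial module. -/
def toTriv : k ≃ₗ[k] Triv p k := LinearEquiv.refl k k

theorem smul_toTriv (u : UHat p k) (c : k) :
    u • (toTriv c : Triv p k) = toTriv (augmentation p k u * c) := rfl

theorem resι_smul_triv (D : Hhat p k) (m : Triv p k) : resι p (Hhat p k) D • m = 0 := by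
  obtain ⟨c, rfl⟩ := toTriv.surjective m
  have : augmentation p k (resι p (Hhat p k) D) = 0 := resLift_resι _ _ D
  rw [smul_toTriv, this, zero_mul, map_zero]

instance : IsScalarTower k (UHat p k) (Triv p k) := ⟨fun c u m => by
  obtain ⟨d, rfl⟩ := toTriv.surjective m
  rw [smul_toTriv, smul_toTriv, map_smul, smul_mul_assoc, map_smul]⟩

omit [Fact p.Prime] [CharP k p] in
theorem finrank_triv : Module.finrank k (Triv p k) = 1 := by
  rw [← (toTriv (p := p) (k := k)).finrank_eq, Module.finrank_self]

variable (p k) in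
theorem isSimpleModule_triv : IsSimpleModule (UHat p k) (Triv p k) := by
  have : Nontrivial (Triv p k) := inferInstanceAs (Nontrivial k)
  rw [isSimpleModule_iff_toSpanSingleton_surjective]
  refine ⟨this, fun m hm m' => ?_⟩
  obtain ⟨c, rfl⟩ := toTriv.surjective m
  obtain ⟨d, rfl⟩ := toTriv.surjective m'
  have hc : c ≠ 0 := fun h => hm (by rw [h, map_zero])
  refine ⟨algebraMap k _ (d / c), ?_⟩
  rw [LinearMap.toSpanSingleton_apply, algebraMap_smul, ← map_smul, smul_eq_mul,
    div_mul_cancel₀ _ hc]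

variable (p k) in
/-- The inclusion of the constants into the functions. -/
def constHom : Triv p k →ₗ[UHat p k] Dens p k 0 :=
  equivariantMap ((toRepMod (densRep p k 0)).toLinearMap ∘ₗ Algebra.linearMap k (Trunc p k) ∘ₗ
    (toTriv (p := p)).symm.toLinearMap) fun D m => by
      rw [resι_smul_triv, map_zero]
      simp only [LinearMap.comp_apply, LinearEquiv.coe_coe, smul_toRepMod, densRep_resι, map_zero,
        Algebra.linearMap_apply, densHom_apply, Derivation.map_algebraMap, zero_smul, add_zero]

theorem constHom_toTriv (c : k) :
    constHom p k (toTriv c) = toRepMod _ (algebraMap k (Trunc p k) c) := rfl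

theorem constHom_injective : Function.Injective (constHom p k) := by
  have hp := (Fact.out : p.Prime).pos
  have : Nontrivial (Trunc p k) := ⟨⟨_, 0, monomial_ne_zero (p := p) (k := k) hp hp⟩⟩
  intro a b h
  obtain ⟨a, rfl⟩ := toTriv.surjective a
  obtain ⟨b, rfl⟩ := toTriv.surjective b
  rw [constHom_toTriv, constHom_toTriv] at h
  rw [(algebraMap k (Trunc p k)).injective ((toRepMod _).injective h)]

variable (p k) in
/-- The coefficient of the top monomial, as a homomorphism to the trivial module. -/
def topCoefHom : Dens p k 1 →ₗ[UHat p k] Triv p k :=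
  equivariantMap ((toTriv (p := p)).toLinearMap ∘ₗ coef (p - 1) (p - 1) ∘ₗ
    (toRepMod (densRep p k 1)).symm.toLinearMap) fun D m => by
      rw [resι_smul_triv]
      simp only [LinearMap.comp_apply, LinearEquiv.coe_coe, toRepMod_symm_smul, densRep_resι,
        map_one, coef_densHom_one, map_zero]

theorem topCoefHom_toRepMod (f : Trunc p k) :
    topCoefHom p k (toRepMod _ f) = toTriv (coef (p - 1) (p - 1) f) := rfl

theorem dOneHom_toRepMod (ω : Trunc p k × Trunc p k) :
    dOneHom p k (toRepMod _ ω) = toRepMod _ (dOne p k ω) := rfl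

theorem topCoefHom_surjective : Function.Surjective (topCoefHom p k) := by
  have hp := (Fact.out : p.Prime).pos
  intro m
  obtain ⟨c, rfl⟩ := toTriv.surjective m
  refine ⟨toRepMod _ (c • (tx p k ^ (p - 1) * ty p k ^ (p - 1))), ?_⟩
  rw [topCoefHom_toRepMod, map_smul, coef_monomial (by omega) (by omega) (by omega) (by omega)]
  simp

theorem range_dOneHom_ne_bot : LinearMap.range (dOneHom p k) ≠ ⊥ := by
  have hp := (Fact.out : p.Prime).pos
  intro h
  have h1 : dOneHom p k (toRepMod _ (0, tx p k)) = 0 := by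
    rw [← Submodule.mem_bot (UHat p k), ← h]
    exact ⟨_, rfl⟩
  rw [dOneHom_toRepMod, map_eq_zero_iff _ (toRepMod _).injective, dOne_apply] at h1
  refine monomial_ne_zero (p := p) (k := k) hp hp ?_
  simpa using h1

/-- No primitives are constructed: the image of `d` is a nonzero submodule, and the kernel of the
top coefficient lies in every nonzero submodule. -/
theorem range_dOneHom (hp : 5 ≤ p) :
    LinearMap.range (dOneHom p k) = LinearMap.ker (topCoefHom p k) := by
  apply le_antisymm
  · rintro _ ⟨m, rfl⟩
    obtain ⟨ω, rfl⟩ := (toRepMod _).surjective m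
    rw [LinearMap.mem_ker, dOneHom_toRepMod, topCoefHom_toRepMod, dOne_apply, map_sub,
      coef_partialD_zero, coef_partialD_one (by omega) (by omega),
      Nat.sub_add_cancel (by omega : 1 ≤ p), CharP.cast_eq_zero, zero_mul, sub_zero, map_zero]
  · intro m hm
    obtain ⟨f, rfl⟩ := (toRepMod _).surjective m
    rw [LinearMap.mem_ker, topCoefHom_toRepMod, map_eq_zero_iff _ toTriv.injective] at hm
    refine (densStable_subspaceOf (LinearMap.range (dOneHom p k))).ker_le hp ?_ hm
    rw [Ne, subspaceOf_eq_bot]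
    exact range_dOneHom_ne_bot

theorem range_constHom_ne_top : LinearMap.range (constHom p k) ≠ ⊤ := by
  have hp := (Fact.out : p.Prime).two_le
  intro h
  have hs : Function.Surjective ((constHom p k).restrictScalars k) :=
    (LinearMap.range_eq_top.1 h : Function.Surjective (constHom p k))
  have h2 := LinearMap.finrank_range_of_inj
    (f := (constHom p k).restrictScalars k) constHom_injective
  rw [LinearMap.range_eq_top.2 hs, finrank_top, finrank_dens, finrank_triv] at h2
  nlinarith

theorem range_constHom_greatest (hp : 5 ≤ p) (N : Submodule (UHat p k) (Dens p k 0)) (hN : N ≠ ⊤) :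
    N ≤ LinearMap.range (constHom p k) := by
  intro m hm
  obtain ⟨f, rfl⟩ := (toRepMod _).surjective m
  have hf : f ∈ Submodule.span k {1} := by
    by_contra h
    exact hN (subspaceOf_eq_top.1 ((densStable_subspaceOf N).eq_top_of_nonconstant hp hm h))
  obtain ⟨c, rfl⟩ := Submodule.mem_span_singleton.1 hf
  exact ⟨toTriv c, by rw [constHom_toTriv, Algebra.algebraMap_eq_smul_one]⟩

theorem ker_dOneHom_ne_top : LinearMap.ker (dOneHom p k) ≠ ⊤ := by
  rw [Ne, LinearMap.ker_eq_top]
  intro h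
  exact range_dOneHom_ne_bot (p := p) (k := k) (by rw [h, LinearMap.range_zero])

theorem ker_dOneHom_greatest (hp : 5 ≤ p) (N : Submodule (UHat p k) (Forms p k)) (hN : N ≠ ⊤) :
    N ≤ LinearMap.ker (dOneHom p k) := by
  by_contra h
  refine hN (subspaceOf_eq_top.1 ((formStable_subspaceOf N).eq_top_of_not_le_ker hp fun h' => h ?_))
  intro m hm
  obtain ⟨ω, rfl⟩ := (toRepMod _).surjective m
  rw [LinearMap.mem_ker, dOneHom_toRepMod, map_eq_zero_iff _ (toRepMod _).injective]
  exact h' hm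

theorem isSimpleModule_dens_iff (hp : 5 ≤ p) (c : ZMod p) :
    IsSimpleModule (UHat p k) (Dens p k c) ↔ c ≠ 0 ∧ c ≠ 1 := by
  constructor
  · intro h
    constructor
    · rintro rfl
      rcases eq_bot_or_eq_top (LinearMap.range (constHom p k)) with h0 | h0
      · have h1 : constHom p k (toTriv 1) = constHom p k 0 := by
          rw [map_zero, ← Submodule.mem_bot (UHat p k), ← h0]
          exact ⟨_, rfl⟩
        have h2 := constHom_injective h1
        rw [map_eq_zero_iff _ toTriv.injective] at h2
        exact one_ne_zero h2
      · exact range_constHom_ne_top h0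
    · rintro rfl
      rcases eq_bot_or_eq_top (LinearMap.range (dOneHom p k)) with h0 | h0
      · exact range_dOneHom_ne_bot h0
      · rw [range_dOneHom hp, LinearMap.ker_eq_top] at h0
        obtain ⟨m, hm⟩ := topCoefHom_surjective (p := p) (toTriv (1 : k))
        rw [h0, LinearMap.zero_apply, eq_comm, map_eq_zero_iff _ toTriv.injective] at hm
        exact one_ne_zero hm
  · rintro ⟨h0, h1⟩
    have hp0 : 0 < p := by omega
    have : Nontrivial (Dens p k c) :=
      ⟨⟨toRepMod _ _, 0, fun h => monomial_ne_zero (p := p) (k := k) hp0 hp0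
        ((map_eq_zero_iff _ (toRepMod _).injective).1 h)⟩⟩
    rw [isSimpleModule_iff]
    exact { eq_bot_or_eq_top := fun N => by
              rw [← subspaceOf_eq_bot, ← subspaceOf_eq_top]
              exact (densStable_subspaceOf N).eq_bot_or_eq_top hp h0 h1 }

theorem finrank_dens_quotient :
    Module.finrank k (Dens p k 0 ⧸ LinearMap.range (constHom p k)) = p ^ 2 - 1 := by
  have h1 := LinearMap.finrank_range_of_inj
    (f := (constHom p k).restrictScalars k) constHom_injective
  have : Module.Finite k (Dens p k 0) := Module.Finite.equiv (toRepMod _)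
  have h2 := Submodule.finrank_quotient_add_finrank
    (LinearMap.range ((constHom p k).restrictScalars k))
  have h3 := (Submodule.Quotient.restrictScalarsEquiv k (LinearMap.range (constHom p k))).finrank_eq
  rw [finrank_triv] at h1
  rw [h1, finrank_dens] at h2
  rw [← h3]
  exact Nat.eq_sub_of_add_eq h2

theorem finrank_ker_topCoefHom : Module.finrank k (LinearMap.ker (topCoefHom p k)) = p ^ 2 - 1 := by
  have : Module.Finite k (Dens p k 1) := Module.Finite.equiv (toRepMod _)
  have hs : Function.Surjective ((topCoefHom p k).restrictScalars k) :=
    topCoefHom_surjective (p := p) (k := k)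
  have h := LinearMap.finrank_range_add_finrank_ker ((topCoefHom p k).restrictScalars k)
  rw [LinearMap.range_eq_top.2 hs, finrank_top, finrank_triv,
    finrank_dens, add_comm] at h
  exact Nat.eq_sub_of_add_eq h

theorem nonempty_equiv_Z_diag (hp : 5 ≤ p) (a : ZMod p) {c : ZMod p} (hc : a + 1 = c) :
    Nonempty (Z p k a a ≃ₗ[UHat p k] Dens p k c) := by
  -- The degree `(a - a).val` is only propositionally zero and occurs in the type, so it is
  -- generalised to `n` before substitution.
  have h : ∀ n : ℕ, n = 0 → Nonempty (IndMod p k n a ≃ₗ[UHat p k] Dens p k (a + 1)) := by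
    rintro _ rfl
    exact nonempty_equiv_dens a hp
  subst hc
  exact h (a - a).val (by rw [sub_self, ZMod.val_zero])

theorem nonempty_equiv_Z_zero_neg_one (hp : 5 ≤ p) :
    Nonempty (Z p k 0 (-1) ≃ₗ[UHat p k] Forms p k) := by
  have h : ∀ n : ℕ, n = 1 → Nonempty (IndMod p k n (-1) ≃ₗ[UHat p k] Forms p k) := by
    rintro _ rfl
    exact nonempty_equiv_forms hp
  have : Fact (1 < p) := ⟨by omega⟩
  exact h (0 - -1 : ZMod p).val (by rw [zero_sub, neg_neg, ZMod.val_one])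

theorem nonempty_equiv_L_neg_one (hp : 5 ≤ p) : Nonempty
    (L p k (-1) (-1) ≃ₗ[UHat p k] (Dens p k 0 ⧸ LinearMap.range (constHom p k))) := by
  obtain ⟨e⟩ := nonempty_equiv_Z_diag (k := k) hp (-1) (neg_add_cancel 1)
  exact ⟨Submodule.Quotient.equiv _ _ e
    (map_jacobson_of_greatest e range_constHom_ne_top (range_constHom_greatest hp))⟩

theorem nonempty_equiv_L_zero_neg_one (hp : 5 ≤ p) :
    Nonempty (L p k 0 (-1) ≃ₗ[UHat p k] (Forms p k ⧸ LinearMap.ker (dOneHom p k))) := by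
  obtain ⟨e⟩ := nonempty_equiv_Z_zero_neg_one (k := k) hp
  exact ⟨Submodule.Quotient.equiv _ _ e
    (map_jacobson_of_greatest e ker_dOneHom_ne_top (ker_dOneHom_greatest hp))⟩

end Trivial

/-! ### Simplicity, composition factors and dimensions. -/

section CompositionFactors

variable {p : ℕ} [Fact p.Prime] {k : Type u} [Field k] [CharP k p]

theorem isSimpleModule_Z_diag_iff (hp : 5 ≤ p) (a : ZMod p) :
    IsSimpleModule (UHat p k) (Z p k a a) ↔ a ≠ 0 ∧ a ≠ -1 := by
  obtain ⟨e⟩ := nonempty_equiv_Z_diag (k := k) hp a rfl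
  rw [LinearEquiv.isSimpleModule_iff e, isSimpleModule_dens_iff hp, Ne, Ne,
    ← eq_neg_iff_add_eq_zero, add_eq_right, and_comm]

theorem hasCompositionFactors_Z_neg_one (hp : 5 ≤ p) :
    HasCompositionFactors (UHat p k) (Z p k (-1) (-1)) (L p k (-1) (-1)) (Triv p k) := by
  obtain ⟨e⟩ := nonempty_equiv_Z_diag (k := k) hp (-1) (neg_add_cancel 1)
  obtain ⟨e'⟩ := nonempty_equiv_L_neg_one (k := k) hp
  refine ⟨?_, isSimpleModule_triv p k, Module.jacobson (UHat p k) (Z p k (-1) (-1)),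
    Or.inr ⟨⟨?_⟩, ⟨LinearEquiv.refl _ _⟩⟩⟩
  · rw [LinearEquiv.isSimpleModule_iff e', isSimpleModule_iff_isCoatom]
    exact isCoatom_of_greatest range_constHom_ne_top (range_constHom_greatest hp)
  · exact (e.submoduleMap _).trans ((LinearEquiv.ofEq _ _
      (map_jacobson_of_greatest e range_constHom_ne_top (range_constHom_greatest hp))).trans
      (LinearEquiv.ofInjective _ constHom_injective).symm)

theorem hasCompositionFactors_Z_zero (hp : 5 ≤ p) :
    HasCompositionFactors (UHat p k) (Z p k 0 0) (L p k 0 (-1)) (Triv p k) := by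
  obtain ⟨e⟩ := nonempty_equiv_Z_diag (k := k) hp 0 (zero_add 1)
  obtain ⟨e'⟩ := nonempty_equiv_L_zero_neg_one (k := k) hp
  refine ⟨?_, isSimpleModule_triv p k, (LinearMap.ker (topCoefHom p k)).comap (e : _ →ₗ[UHat p k] _),
    Or.inl ⟨⟨?_⟩, ⟨?_⟩⟩⟩
  · rw [LinearEquiv.isSimpleModule_iff e', isSimpleModule_iff_isCoatom]
    exact isCoatom_of_greatest ker_dOneHom_ne_top (ker_dOneHom_greatest hp)
  · refine ((e.submoduleMap _).trans (LinearEquiv.ofEq _ (LinearMap.range (dOneHom p k)) ?_)).trans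
      ((dOneHom p k).quotKerEquivRange.symm.trans e'.symm)
    rw [range_dOneHom hp]
    exact Submodule.map_comap_eq_of_surjective e.surjective _
  · refine (Submodule.Quotient.equiv _ (LinearMap.ker (topCoefHom p k)) e ?_).trans
      ((topCoefHom p k).quotKerEquivOfSurjective topCoefHom_surjective)
    exact Submodule.map_comap_eq_of_surjective e.surjective _

theorem finrank_L_neg_one (hp : 5 ≤ p) : Module.finrank k (L p k (-1) (-1)) = p ^ 2 - 1 := by
  obtain ⟨e⟩ := nonempty_equiv_L_neg_one (k := k) hp
  rw [(e.restrictScalars k).finrank_eq, finrank_dens_quotient]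

theorem finrank_L_zero_neg_one (hp : 5 ≤ p) : Module.finrank k (L p k 0 (-1)) = p ^ 2 - 1 := by
  obtain ⟨e⟩ := nonempty_equiv_L_zero_neg_one (k := k) hp
  rw [((e.trans ((dOneHom p k).quotKerEquivRange.trans
    (LinearEquiv.ofEq _ _ (range_dOneHom hp)))).restrictScalars k).finrank_eq,
    finrank_ker_topCoefHom]

end CompositionFactors

end HamiltonianModules

end

theorem mainTheorem2 (p : ℕ) [Fact p.Prime] (hp : 5 ≤ p)
    (k : Type*) [Field k] [IsAlgClosed k] [CharP k p] :
    (∀ a : ZMod p, IsSimpleModule (HamiltonianModules.UHat p k) (HamiltonianModules.Z p k a a) ↔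
      a ≠ 0 ∧ a ≠ -1) ∧
    HamiltonianModules.HasCompositionFactors (HamiltonianModules.UHat p k)
      (HamiltonianModules.Z p k (-1) (-1))
      (HamiltonianModules.L p k (-1) (-1)) (HamiltonianModules.Triv p k) ∧
    Module.finrank k (HamiltonianModules.L p k (-1) (-1)) = p ^ 2 - 1 ∧
    HamiltonianModules.HasCompositionFactors (HamiltonianModules.UHat p k)
      (HamiltonianModules.Z p k 0 0)
      (HamiltonianModules.L p k 0 (-1)) (HamiltonianModules.Triv p k) ∧
    Module.finrank k (HamiltonianModules.L p k 0 (-1)) = p ^ 2 - 1 :=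
  ⟨fun a => HamiltonianModules.isSimpleModule_Z_diag_iff hp a,
    HamiltonianModules.hasCompositionFactors_Z_neg_one hp,
    HamiltonianModules.finrank_L_neg_one hp,
    HamiltonianModules.hasCompositionFactors_Z_zero hp,
    HamiltonianModules.finrank_L_zero_neg_one hp⟩
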